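/- **Setting.** Let $\Lambda$ be a finite metric space (the sites), each site $x$ carrying a finite-dimensional Hilbert space, and let $\mathcal H=\bigotimes_{x\in\Lambda}\mathcal H_x$. An operator is supported on a region $Z\subseteq\Lambda$ if it has the form $M\otimes 1$ with $M$ acting on $\bigotimes_{x\in Z}\mathcal H_x$. For constants $\mu>0$ and $J$, a *differentiable family of local Hamiltonians* is $H(g)=\sum_{Z\subseteq\Lambda}H_Z(g)$, $g\in[0,1]$, where each $H_Z(g)$ is Hermitian, supported on $Z$ and differentiable in $g$ (one-sidedly at the end points), $\partial_gH$ is integrable on $[0,1]$, and for all $g\in[0,1]$ and all sites $u$ $$\sum_{Z\ni u}\|H_Z(g)\|\,|Z|\,e^{\mu\,\mathrm{diam}(Z)}\le J .$$ A unit vector $|\Phi\rangle$ is a ground state of $H$ with gap at least $\Delta>0$ if $H|\Phi\rangle=E_0|\Phi\rangle$ and every eigenvector of $H$ orthogonal to $|\Phi\rangle$ has eigenvalue at least $E_0+\Delta$. A *filter function* for $\Delta$ is an integrable odd function $F:\mathbb R\to\mathbb C$ such that $\tilde F(\omega)=\int F(t)e^{i\omega t}\,dt$ is infinitely differentiable and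 $\tilde F(\omega)=-1/\omega$ for $|\omega|>\Delta$. Put $$\tilde H(g)=i\int F(t)\,e^{iH(g)t}\,(\partial_gH(g))\,e^{-iH(g)t}\,dt,\qquad \tilde H_Z(g)=i\int F(t)\,e^{iH(g)t}\,(\partial_gH_Z(g))\,e^{-iH(g)t}\,dt,$$ and let $U(s)=\mathcal T\exp\big(-i\int_0^s\tilde H(g)\,dg\big)$ be the sum of the Dyson series. **Theorem.** Let $\Delta>0$. There is a filter function for $\Delta$, and it can be chosen purely imaginary. For every filter function $F$ for $\Delta$, every $\mu>0$ and every $J$ there is a function $h'(l)$, decaying as $l\to\infty$ faster than every negative power of $l$, such that the following holds for every finite system and every differentiable family of local Hamiltonians with constants $\mu,J$ such that for every $g\in[0,1]$ the unit vector $|\Phi(g)\rangle$ is a ground state of $H(g)$ with gap at least $\Delta$ (in particular, $h'$ does not depend on the size of the system). 1. $\tilde H$ is integrable on $[0,1]$, the Dyson series of $U(s)$ converges for all $s\in[0,1]$, and $U(s)|\Phi(0)\rangle=|\Phi(s)\rangle$ up to a phase factor; in particular $|\Phi(1)\rangle=\mathcal T\exp\big(-i\int_0^1\tilde H(g)\,dg\big)|\Phi(0)\rangle$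 as states. If $g\mapsto|\Phi(g)\rangle$ is differentiable and $\langle\Phi(g)|\partial_g\Phi(g)\rangle=0$ on $[0,1]$, then $|\Phi(s)\rangle=U(s)|\Phi(0)\rangle$ exactly for all $s\in[0,1]$. 2. If $F$ is purely imaginary (so that $\tilde F$ is real), then all $\tilde H_Z(s)$ and $\tilde H(s)$ are Hermitian and $U(s)$ is unitary, for all $s\in[0,1]$. 3. For every $g\in[0,1]$, $\tilde H(g)=\sum_Z\tilde H_Z(g)$, and $\tilde H(g)$ is quasi-local: for every region $Z$, every site $B$ and every operator $O_B$ supported on $B$, $$\big\|[\tilde H_Z(g),O_B]\big\|\le h'(\mathrm{dist}(Z,B))\,|Z|\,\|\partial_gH_Z(g)\|\,\|O_B\| ,$$ where $\mathrm{dist}(Z,B)$ is the smallest distance between $B$ and a site of $Z$. -/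

import Mathlib

open MeasureTheory Set
open scoped ContDiff

noncomputable section

/-! ### Finite quantum lattice systems

A system consists of a finite metric space `Λ` of sites and, for every site `x`, a finite set `σ x`
labelling an orthonormal basis of the Hilbert space of that site. -/

/-- The many-body Hilbert space `⨂ₓ ℂ^(σ x)`, written in the product basis. -/
abbrev StateSpace {Λ : Type*} (σ : Λ → Type*) : Type _ :=
  EuclideanSpace ℂ (∀ x, σ x)

/-- Operators on the many-body Hilbert space, with the operator norm. -/
abbrev Op {Λ : Type*} [Fintype Λ] [DecidableEq Λ] (σ : Λ → Type*) [∀ x, Fintype (σ x)] : Type _ :=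
  StateSpace σ →L[ℂ] StateSpace σ

/-- The operator `A` is supported on the region `Z`: it has the form `M ⊗ 1`, with `M` acting on the
sites of `Z` and the identity acting on all other sites. -/
def SupportedOn {Λ : Type*} [Fintype Λ] [DecidableEq Λ] {σ : Λ → Type*} [∀ x, Fintype (σ x)]
    [∀ x, DecidableEq (σ x)] (Z : Finset Λ) (A : Op σ) : Prop :=
  ∃ M : Matrix (∀ x : Z, σ x) (∀ x : Z, σ x) ℂ, ∀ a b : ∀ x, σ x,
    A (EuclideanSpace.single b 1) a =
      if ∀ x, x ∉ Z → a x = b x then M (Z.restrict a) (Z.restrict b) else 0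

/-- The total Hamiltonian `H(g) = ∑_Z H_Z(g)`. The sum runs over all regions; a region that carries
no interaction has `H_Z = 0`. -/
def totalHamiltonian {Λ : Type*} [Fintype Λ] [DecidableEq Λ] {σ : Λ → Type*} [∀ x, Fintype (σ x)]
    (H : Finset Λ → ℝ → Op σ) (g : ℝ) : Op σ :=
  ∑ Z : Finset Λ, H Z g

/-- The derivative along the path `g ∈ [0,1]` (one-sided at the end points). -/
def pathDeriv {E : Type*} [NormedAddCommGroup E] [NormedSpace ℝ E] (f : ℝ → E) (g : ℝ) : E :=
  derivWithin f (Icc 0 1) g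

/-- `H Z g`, for regions `Z` and `0 ≤ g ≤ 1`, are the terms of a differentiable family of local
Hamiltonians, with decay rate `μ` and interaction strength at most `J`. -/
structure IsLocalFamily {Λ : Type*} [Fintype Λ] [DecidableEq Λ] [MetricSpace Λ]
    {σ : Λ → Type*} [∀ x, Fintype (σ x)] [∀ x, DecidableEq (σ x)]
    (μ J : ℝ) (H : Finset Λ → ℝ → Op σ) : Prop where
  supported : ∀ Z, ∀ g ∈ Icc (0 : ℝ) 1, SupportedOn Z (H Z g)
  selfAdjoint : ∀ Z, ∀ g ∈ Icc (0 : ℝ) 1, IsSelfAdjoint (H Z g)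
  local_bound : ∀ g ∈ Icc (0 : ℝ) 1, ∀ u : Λ,
    ∑ Z : Finset Λ with u ∈ Z,
      ‖H Z g‖ * (Z.card : ℝ) * Real.exp (μ * Metric.diam (Z : Set Λ)) ≤ J
  differentiable : ∀ Z, DifferentiableOn ℝ (H Z) (Icc 0 1)
  /-- `∂_g H` can be integrated over `[0,1]`, as the ordered exponential requires. -/
  integrable_deriv : IntervalIntegrable (pathDeriv (totalHamiltonian H)) volume 0 1

/-- `Φ` is a normalized ground state of `H`, and every eigenstate of `H` orthogonal to `Φ` lies
in energy at least `Δ` above it. -/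
def IsGappedGroundState {E : Type*} [NormedAddCommGroup E] [InnerProductSpace ℂ E]
    (Δ : ℝ) (H : E →L[ℂ] E) (Φ : E) : Prop :=
  ‖Φ‖ = 1 ∧ ∃ E₀ : ℝ, H Φ = (E₀ : ℂ) • Φ ∧
    ∀ (e : ℝ) (ψ : E), ψ ≠ 0 → inner ℂ Φ ψ = 0 → H ψ = (e : ℂ) • ψ → E₀ + Δ ≤ e

/-! ### The quasi-adiabatic generator -/

/-- The Fourier transform `F̃(w) = ∫ F(t) e^{iwt} dt`. -/
def timeFourier (F : ℝ → ℂ) (w : ℝ) : ℂ :=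
  ∫ t : ℝ, F t * Complex.exp (Complex.I * w * t)

/-- The filter functions for the gap `Δ`. -/
structure IsFilterFunction (Δ : ℝ) (F : ℝ → ℂ) : Prop where
  integrable : Integrable F
  fourier_eq : ∀ w : ℝ, Δ < |w| → timeFourier F w = -1 / (w : ℂ)
  fourier_smooth : ContDiff ℝ ∞ (timeFourier F)
  odd : ∀ t, F t = -F (-t)

/-- `i ∫ F(t) e^{iHt} D e^{-iHt} dt`. -/
def filteredOp {E : Type*} [NormedAddCommGroup E] [NormedSpace ℂ E]
    (F : ℝ → ℂ) (H D : E →L[ℂ] E) : E →L[ℂ] E :=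
  Complex.I • ∫ t : ℝ, F t •
    (NormedSpace.exp ((Complex.I * (t : ℂ)) • H) * D *
      NormedSpace.exp ((-(Complex.I * (t : ℂ))) • H))

/-- The generator `H̃(g) = i ∫ F(t) e^{iH(g)t} (∂_g H(g)) e^{-iH(g)t} dt`. -/
def quasiAdiabatic {Λ : Type*} [Fintype Λ] [DecidableEq Λ] {σ : Λ → Type*} [∀ x, Fintype (σ x)]
    (F : ℝ → ℂ) (H : Finset Λ → ℝ → Op σ) (g : ℝ) : Op σ :=
  filteredOp F (totalHamiltonian H g) (pathDeriv (totalHamiltonian H) g)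

/-- The term `H̃_Z(g) = i ∫ F(t) e^{iH(g)t} (∂_g H_Z(g)) e^{-iH(g)t} dt` of the generator. -/
def quasiAdiabaticTerm {Λ : Type*} [Fintype Λ] [DecidableEq Λ] {σ : Λ → Type*}
    [∀ x, Fintype (σ x)] (F : ℝ → ℂ) (H : Finset Λ → ℝ → Op σ) (Z : Finset Λ) (g : ℝ) : Op σ :=
  filteredOp F (totalHamiltonian H g) (pathDeriv (H Z) g)

/-! ### The path-ordered exponential -/

/-- The `n`-th term of the Dyson series,
`(-i)^n ∫_{0 ≤ g₁ ≤ ⋯ ≤ gₙ ≤ s} K(gₙ) ⋯ K(g₁) dg₁ ⋯ dgₙ`. -/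
def dysonTerm {E : Type*} [NormedAddCommGroup E] [NormedSpace ℂ E] (K : ℝ → E →L[ℂ] E) :
    ℕ → ℝ → E →L[ℂ] E
  | 0, _ => 1
  | n + 1, s => (-Complex.I) • ∫ g in (0 : ℝ)..s, K g * dysonTerm K n g

/-- The path-ordered exponential `T exp(-i ∫₀ˢ K(g) dg)`: the sum of the Dyson series. -/
def orderedExp {E : Type*} [NormedAddCommGroup E] [NormedSpace ℂ E] (K : ℝ → E →L[ℂ] E)
    (s : ℝ) : E →L[ℂ] E :=
  ∑' n, dysonTerm K n s

end

/-! The generator `H̃` of quasi-adiabatic continuation is the generator of parallel transport, seen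
through a filter that only reproduces first-order perturbation theory for energy denominators of
size at least `Δ`; in exchange, the filter decays fast enough in time to keep `H̃` local.

*Filter functions.* The existence of a purely imaginary one is `exists_filterFunction`: if the even
rapidly decreasing function `p` has a bump function supported in `[-Δ, Δ]` as its cosine transform,
normalized to `1` at zero, then the odd function equal to `i ∫_t^∞ p` for `t > 0` has Fourier
transform `-1/w` for `|w| > Δ`, by integration by parts. All moments of that function are finite.
Two filter functions for the same gap differ by a function whose Fourier transform is smooth and
compactly supported, hence by a Schwartz function, so every filter function has finite moments
(`IsFilterFunction.integrable_pow_mul`).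

*Quasi-locality.* The Lieb–Robinson bound `liebRobinson` follows from an integral inequality
(`norm_commutator_heisenberg_le`): for `A` supported on `X`, only the interactions that meet `X`
move `A`, up to a unitary conjugation that fixes `A`. Inserting a bound with constant `K` on the
right-hand side returns the same bound with constant `2 + K / 2`, so the crude bound, whose constant
depends on the system, improves to the universal constant `4`. Splitting the time integral of the
generator at a time proportional to the distance gives the decay profile
(`commutator_filteredOp_le_decayProfile`).

*Transport of the ground state.* Expanding in eigenvectors of `H` shows that `H̃ Φ` is orthogonal to
`Φ`, and that `(H - E₀) H̃ Φ = -i (∂H - ⟨Φ, ∂H Φ⟩) Φ` (`filteredOp_apply_groundState`). The energy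
`E₀` is differentiable by the variational principle, without any regularity of `Φ`
(`hasDerivWithinAt_groundEnergy`). Therefore, if `ψ` solves `ψ' = -i H̃ ψ`, the derivative of
`χ = (H - E₀) ψ` is an operator that annihilates the ground state, applied to `ψ`, and the gap
bounds it by a multiple of `‖χ‖` with an integrable coefficient. Since `χ` vanishes initially, it
vanishes identically by Grönwall's lemma, and `ψ` stays proportional to the ground state
(`IsGappedPath.apply_orderedExp_eq`). Its norm is constant because `H̃` has no diagonal matrix
element in the ground state; this does not require `H̃` to be Hermitian. A parallel transported
differentiable `Φ` solves the same equation, so it coincides with `ψ`.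

As `∂H` is merely integrable, all evolution equations hold in the sense of absolutely continuous
curves (`IsPrimitive`); the product rule `IsPrimitive.bilinear` makes them as usable as classical
ones. -/

/-! ### Absolutely continuous curves -/

/-- `a` is absolutely continuous on `[0,1]` with almost-everywhere derivative `α`: it is the
integral of the integrable function `α`. -/
structure IsPrimitive {E : Type*} [NormedAddCommGroup E] [NormedSpace ℝ E] (a α : ℝ → E) :
    Prop where
  integrable : IntervalIntegrable α volume 0 1
  eq_integral : ∀ s ∈ Icc (0 : ℝ) 1, a s = a 0 + ∫ g in (0 : ℝ)..s, α g

lemma IntervalIntegrable.mono_unit {E : Type*} [NormedAddCommGroup E] {f : ℝ → E}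
    (hf : IntervalIntegrable f volume 0 1) {x y : ℝ}
    (hx : x ∈ Icc (0 : ℝ) 1) (hy : y ∈ Icc (0 : ℝ) 1) : IntervalIntegrable f volume x y :=
  hf.mono_set (by
    rw [uIcc_of_le (zero_le_one' ℝ)]
    exact uIcc_subset_Icc hx hy)

/-- A curve whose increments are dominated by those of an absolutely continuous function is
absolutely continuous. -/
lemma absolutelyContinuousOnInterval_of_dist_le {E : Type*}
    [NormedAddCommGroup E] {c : ℝ → E} {N : ℝ → ℝ} {p q : ℝ}
    (hN : AbsolutelyContinuousOnInterval N p q)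
    (h : ∀ x ∈ uIcc p q, ∀ y ∈ uIcc p q, dist (c x) (c y) ≤ dist (N x) (N y)) :
    AbsolutelyContinuousOnInterval c p q := by
  rw [absolutelyContinuousOnInterval_iff] at hN ⊢
  intro ε hε
  obtain ⟨δ, hδ, H⟩ := hN ε hε
  refine ⟨δ, hδ, fun I hI hI' => (Finset.sum_le_sum fun i hi => ?_).trans_lt (H I hI hI')⟩
  exact h _ (hI.1 i hi).1 _ (hI.1 i hi).2

section Primitive

variable {E F G : Type*} [NormedAddCommGroup E] [NormedSpace ℝ E] [NormedAddCommGroup F]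
  [NormedSpace ℝ F] [NormedAddCommGroup G] [NormedSpace ℝ G]

namespace IsPrimitive

variable {a α : ℝ → E} {b β : ℝ → F}

lemma sub_eq (h : IsPrimitive a α) {x y : ℝ} (hx : x ∈ Icc (0 : ℝ) 1) (hy : y ∈ Icc (0 : ℝ) 1) :
    a y - a x = ∫ g in x..y, α g := by
  have h0 : (0 : ℝ) ∈ Icc (0 : ℝ) 1 := by simp
  rw [h.eq_integral y hy, h.eq_integral x hx, add_sub_add_left_eq_sub,
    intervalIntegral.integral_interval_sub_left (h.integrable.mono_unit h0 hy)
      (h.integrable.mono_unit h0 hx)]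

lemma of_integral {α : ℝ → E} (hα : IntervalIntegrable α volume 0 1) (c : E) :
    IsPrimitive (fun s => c + ∫ g in (0 : ℝ)..s, α g) α :=
  ⟨hα, fun s _ => by simp⟩

lemma continuousOn (h : IsPrimitive a α) : ContinuousOn a (Icc 0 1) := by
  have h1 : ContinuousOn (fun s => a 0 + ∫ g in (0 : ℝ)..s, α g) (Icc 0 1) := by
    have := intervalIntegral.continuousOn_primitive_interval (a := (0 : ℝ)) (b := 1) (f := α)
      (μ := volume) (by
        have := h.integrable
        rwa [intervalIntegrable_iff_integrableOn_Icc_of_le zero_le_one,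
          ← uIcc_of_le (zero_le_one' ℝ)] at this)
    rw [uIcc_of_le (zero_le_one' ℝ)] at this
    exact continuousOn_const.add this
  exact h1.congr h.eq_integral

lemma exists_bound (h : IsPrimitive a α) : ∃ C, 0 ≤ C ∧ ∀ s ∈ Icc (0 : ℝ) 1, ‖a s‖ ≤ C := by
  obtain ⟨C, hC⟩ := isCompact_Icc.exists_bound_of_continuousOn h.continuousOn
  exact ⟨C, (norm_nonneg _).trans (hC 0 (by simp)), hC⟩

lemma norm_sub_le (h : IsPrimitive a α) {x y : ℝ} (hx : x ∈ Icc (0 : ℝ) 1)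
    (hy : y ∈ Icc (0 : ℝ) 1) : ‖a y - a x‖ ≤ |∫ g in x..y, ‖α g‖| := by
  rw [h.sub_eq hx hy]
  exact intervalIntegral.norm_integral_le_abs_integral_norm

lemma ae_hasDerivAt [CompleteSpace E] (h : IsPrimitive a α) :
    ∀ᵐ x, x ∈ Ioo (0 : ℝ) 1 → HasDerivAt a (α x) x := by
  filter_upwards [h.integrable.ae_hasDerivAt_integral] with x hx hx01
  have h1 := (hx (by rw [uIcc_of_le zero_le_one]; exact Ioo_subset_Icc_self hx01) 0
    (by simp)).const_add (a 0)
  refine h1.congr_of_eventuallyEq ?_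
  filter_upwards [Ioo_mem_nhds hx01.1 hx01.2] with y hy
  exact h.eq_integral y (Ioo_subset_Icc_self hy)

lemma congr {a' α' : ℝ → E} (h : IsPrimitive a α) (ha : ∀ s ∈ Icc (0 : ℝ) 1, a' s = a s)
    (hα : ∀ s ∈ Icc (0 : ℝ) 1, α' s = α s) : IsPrimitive a' α' := by
  refine ⟨h.integrable.congr ?_, fun s hs => ?_⟩
  · intro x hx
    rw [uIoc_of_le zero_le_one] at hx
    exact (hα x (Ioc_subset_Icc_self hx)).symm
  · rw [ha s hs, ha 0 (by simp), h.eq_integral s hs]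
    congr 1
    refine intervalIntegral.integral_congr fun x hx => ?_
    rw [uIcc_of_le hs.1] at hx
    exact (hα x ⟨hx.1, hx.2.trans hs.2⟩).symm

lemma clm_comp [CompleteSpace E] [CompleteSpace F] (L : E →L[ℝ] F) (h : IsPrimitive a α) :
    IsPrimitive (fun s => L (a s)) (fun s => L (α s)) := by
  refine ⟨?_, fun s hs => ?_⟩
  · have := h.integrable
    rw [intervalIntegrable_iff] at this ⊢
    exact L.integrable_comp this
  · rw [h.eq_integral s hs, map_add,
      L.intervalIntegral_comp_comm (h.integrable.mono_unit (by simp) hs)]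

lemma sub {a' α' : ℝ → E} (h : IsPrimitive a α) (h' : IsPrimitive a' α') :
    IsPrimitive (fun s => a s - a' s) (fun s => α s - α' s) := by
  refine ⟨h.integrable.sub h'.integrable, fun s hs => ?_⟩
  rw [intervalIntegral.integral_sub (h.integrable.mono_unit (by simp) hs)
    (h'.integrable.mono_unit (by simp) hs), h.eq_integral s hs, h'.eq_integral s hs]
  abel

lemma eq_of_deriv_zero (h : IsPrimitive a α) (hα : ∀ s ∈ Icc (0 : ℝ) 1, α s = 0) {s : ℝ}
    (hs : s ∈ Icc (0 : ℝ) 1) : a s = a 0 := by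
  rw [h.eq_integral s hs, intervalIntegral.integral_congr (g := fun _ => 0)]
  · simp
  · intro x hx
    rw [uIcc_of_le hs.1] at hx
    exact hα x ⟨hx.1, hx.2.trans hs.2⟩

/-- The fundamental theorem of calculus for an everywhere differentiable curve whose derivative
is integrable. -/
lemma of_hasDerivWithinAt [CompleteSpace E] (hα : IntervalIntegrable α volume 0 1)
    (h : ∀ s ∈ Icc (0 : ℝ) 1, HasDerivWithinAt a (α s) (Icc 0 1) s) : IsPrimitive a α := by
  refine ⟨hα, fun s hs => ?_⟩
  rw [intervalIntegral.integral_eq_sub_of_hasDeriv_right_of_le hs.1 (f := a)]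
  · abel
  · exact fun x hx => ((h x ⟨hx.1, hx.2.trans hs.2⟩).continuousWithinAt).mono
      (Icc_subset_Icc_right hs.2)
  · intro x hx
    have h2 : Icc (0 : ℝ) 1 ∈ nhds x := Icc_mem_nhds hx.1 (hx.2.trans_le hs.2)
    exact ((h x ⟨hx.1.le, hx.2.le.trans hs.2⟩).hasDerivAt h2).hasDerivWithinAt
  · exact hα.mono_unit (by simp) hs

end IsPrimitive

/-- The product rule for absolutely continuous curves and a bounded bilinear map. -/
theorem IsPrimitive.bilinear [CompleteSpace E] [CompleteSpace F] [CompleteSpace G]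
    {a α : ℝ → E} {b β : ℝ → F} {B : E × F → G} (hB : IsBoundedBilinearMap ℝ B)
    (ha : IsPrimitive a α) (hb : IsPrimitive b β) :
    IsPrimitive (fun s => B (a s, b s)) (fun s => B (α s, b s) + B (a s, β s)) := by
  obtain ⟨C, hC0, hC⟩ := hB.bound
  obtain ⟨Ma, hMa0, hMa⟩ := ha.exists_bound
  obtain ⟨Mb, hMb0, hMb⟩ := hb.exists_bound
  have h01 : uIcc (0 : ℝ) 1 = Icc 0 1 := uIcc_of_le zero_le_one
  have hU : uIoc (0 : ℝ) 1 = Ioc 0 1 := uIoc_of_le zero_le_one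
  have hma : AEStronglyMeasurable a (volume.restrict (Ioc (0 : ℝ) 1)) :=
    (ha.continuousOn.mono Ioc_subset_Icc_self).aestronglyMeasurable measurableSet_Ioc
  have hmb : AEStronglyMeasurable b (volume.restrict (Ioc (0 : ℝ) 1)) :=
    (hb.continuousOn.mono Ioc_subset_Icc_self).aestronglyMeasurable measurableSet_Ioc
  have hα := ha.integrable
  have hβ := hb.integrable
  rw [intervalIntegrable_iff, hU] at hα hβ
  -- the integrand of the product rule is integrable
  have hγ1 : IntervalIntegrable (fun s => B (α s, b s)) volume 0 1 := by
    rw [intervalIntegrable_iff, hU]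
    refine Integrable.mono' (hα.norm.const_mul (C * Mb))
      (hB.continuous.comp_aestronglyMeasurable (hα.1.prodMk hmb)) ?_
    filter_upwards [ae_restrict_mem measurableSet_Ioc] with x hx
    calc _ ≤ C * ‖α x‖ * ‖b x‖ := hC _ _
      _ ≤ C * ‖α x‖ * Mb := by gcongr; exact hMb x (Ioc_subset_Icc_self hx)
      _ = _ := by ring
  have hγ2 : IntervalIntegrable (fun s => B (a s, β s)) volume 0 1 := by
    rw [intervalIntegrable_iff, hU]
    refine Integrable.mono' (hβ.norm.const_mul (C * Ma))
      (hB.continuous.comp_aestronglyMeasurable (hma.prodMk hβ.1)) ?_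
    filter_upwards [ae_restrict_mem measurableSet_Ioc] with x hx
    calc _ ≤ C * ‖a x‖ * ‖β x‖ := hC _ _
      _ ≤ C * Ma * ‖β x‖ := by gcongr; exact hMa x (Ioc_subset_Icc_self hx)
      _ = _ := by ring
  have hγ := hγ1.add hγ2
  set γ : ℝ → G := fun s => B (α s, b s) + B (a s, β s) with hγdef
  refine ⟨hγ, ?_⟩
  have hPγ := IsPrimitive.of_integral hγ 0
  -- the defect of the product rule is absolutely continuous with derivative zero
  set c : ℝ → G := fun s => B (a s, b s) - (0 + ∫ g in (0 : ℝ)..s, γ g) with hc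
  set k : ℝ → ℝ := fun g => C * Mb * ‖α g‖ + C * Ma * ‖β g‖ + ‖γ g‖ with hk
  have hkint : IntervalIntegrable k volume 0 1 :=
    ((ha.integrable.norm.const_mul _).add (hb.integrable.norm.const_mul _)).add hγ.norm
  have hAC : AbsolutelyContinuousOnInterval c 0 1 := by
    refine absolutelyContinuousOnInterval_of_dist_le
      (hkint.absolutelyContinuousOnInterval_intervalIntegral (c := 0) (by simp)) ?_
    rw [h01]
    have main : ∀ x ∈ Icc (0 : ℝ) 1, ∀ y ∈ Icc (0 : ℝ) 1, x ≤ y →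
        dist (c x) (c y) ≤ dist (∫ v in (0 : ℝ)..x, k v) (∫ v in (0 : ℝ)..y, k v) := by
      intro x hx y hy hxy
      have e1 : c y - c x = B (a y - a x, b y) + B (a x, b y - b x) -
          ((0 + ∫ g in (0 : ℝ)..y, γ g) - (0 + ∫ g in (0 : ℝ)..x, γ g)) := by
        simp only [hc, hB.map_sub_left, hB.map_sub_right]
        abel
      have nα : 0 ≤ ∫ g in x..y, ‖α g‖ :=
        intervalIntegral.integral_nonneg hxy fun _ _ => norm_nonneg _
      have nβ : 0 ≤ ∫ g in x..y, ‖β g‖ :=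
        intervalIntegral.integral_nonneg hxy fun _ _ => norm_nonneg _
      have nγ : 0 ≤ ∫ g in x..y, ‖γ g‖ :=
        intervalIntegral.integral_nonneg hxy fun _ _ => norm_nonneg _
      have iα := ha.integrable.norm.mono_unit hx hy
      have iβ := hb.integrable.norm.mono_unit hx hy
      have iγ := hγ.norm.mono_unit hx hy
      have e2 : ∫ v in x..y, k v = C * Mb * (∫ g in x..y, ‖α g‖) +
          C * Ma * (∫ g in x..y, ‖β g‖) + ∫ g in x..y, ‖γ g‖ := by
        simp only [hk]
        rw [intervalIntegral.integral_add ((iα.const_mul _).add (iβ.const_mul _)) iγ,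
          intervalIntegral.integral_add (iα.const_mul _) (iβ.const_mul _),
          intervalIntegral.integral_const_mul, intervalIntegral.integral_const_mul]
      rw [dist_comm, dist_eq_norm, e1, dist_comm, dist_eq_norm,
        intervalIntegral.integral_interval_sub_left (hkint.mono_unit (by simp) hy)
          (hkint.mono_unit (by simp) hx), e2]
      refine le_trans ?_ (Real.le_norm_self _)
      have d1 := ha.norm_sub_le hx hy
      have d2 := hb.norm_sub_le hx hy
      have d3 := hPγ.norm_sub_le hx hy
      rw [abs_of_nonneg ‹_›] at d1 d2 d3
      refine (_root_.norm_sub_le _ _).trans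
        (add_le_add ((norm_add_le _ _).trans (add_le_add ?_ ?_)) d3)
      · calc _ ≤ C * ‖a y - a x‖ * ‖b y‖ := hC _ _
          _ ≤ C * (∫ g in x..y, ‖α g‖) * Mb := by gcongr; exact hMb y hy
          _ = _ := by ring
      · calc _ ≤ C * ‖a x‖ * ‖b y - b x‖ := hC _ _
          _ ≤ C * Ma * (∫ g in x..y, ‖β g‖) := by gcongr; exact hMa x hx
    intro x hx y hy
    rcases le_total x y with h | h
    · exact main x hx y hy h
    · rw [dist_comm, dist_comm (∫ v in (0 : ℝ)..x, k v)]
      exact main y hy x hx h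
  have hder : ∀ᵐ x, x ∈ uIcc (0 : ℝ) 1 → HasDerivAt c 0 x := by
    have hne : ∀ᵐ x : ℝ, x ∉ ({0, 1} : Set ℝ) :=
      (measure_eq_zero_iff_ae_notMem).1 ((Set.toFinite _).measure_zero _)
    filter_upwards [ha.ae_hasDerivAt, hb.ae_hasDerivAt, hPγ.ae_hasDerivAt, hne]
      with x h1 h2 h3 hx hx'
    rw [h01] at hx'
    simp only [mem_insert_iff, mem_singleton_iff, not_or] at hx
    have hx1 : x ∈ Ioo (0 : ℝ) 1 := ⟨lt_of_le_of_ne hx'.1 (Ne.symm hx.1),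
      lt_of_le_of_ne hx'.2 hx.2⟩
    have h4 : HasDerivAt (fun s => B (a s, b s)) (γ x) x := by
      have := (hB.hasFDerivAt (a x, b x)).comp_hasDerivAt x ((h1 hx1).prodMk (h2 hx1))
      simp only [IsBoundedBilinearMap.deriv_apply] at this
      rw [add_comm] at this
      exact this
    have := h4.sub (h3 hx1)
    rwa [sub_self] at this
  obtain ⟨d, hd⟩ := hAC.const_of_ae_hasDerivAt_zero hder
  rw [h01] at hd
  intro s hs
  have e := (hd s hs).trans (hd 0 (by simp)).symm
  simp only [hc, zero_add, intervalIntegral.integral_same, sub_zero] at e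
  exact sub_eq_iff_eq_add.1 e

lemma IsPrimitive.pow {N k : ℝ → ℝ} (h : IsPrimitive N k) (n : ℕ) :
    IsPrimitive (fun s => N s ^ (n + 1)) (fun s => (n + 1) * (k s * N s ^ n)) := by
  induction n with
  | zero => simpa using h
  | succ n ih =>
    refine (IsPrimitive.bilinear (isBoundedBilinearMap_mul (𝕜 := ℝ) (A := ℝ)) ih h).congr
      (fun s _ => ?_) (fun s _ => ?_)
    · simp only; ring
    · simp only; push_cast; ring

/-- The iterated integrals of `k` that occur in Picard iteration. -/
lemma integral_mul_primitive_pow {k : ℝ → ℝ} (hk : IntervalIntegrable k volume 0 1) (n : ℕ)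
    {s : ℝ} (hs : s ∈ Icc (0 : ℝ) 1) :
    ∫ g in (0 : ℝ)..s, k g * ((∫ v in (0 : ℝ)..g, k v) ^ n / n.factorial) =
      (∫ v in (0 : ℝ)..s, k v) ^ (n + 1) / (n + 1).factorial := by
  have h := ((IsPrimitive.of_integral hk 0).pow n).eq_integral s hs
  simp only [zero_add, intervalIntegral.integral_same, ne_eq, Nat.add_eq_zero_iff, one_ne_zero,
    and_false, not_false_eq_true, zero_pow] at h
  rw [h, intervalIntegral.integral_const_mul, Nat.factorial_succ]
  simp_rw [← mul_div_assoc]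
  rw [intervalIntegral.integral_div]
  push_cast
  have h1 : ((n : ℝ) + 1) ≠ 0 := by positivity
  field_simp

lemma intervalIntegrable_mul_primitive_pow {k : ℝ → ℝ} (hk : IntervalIntegrable k volume 0 1)
    (n : ℕ) : IntervalIntegrable
      (fun g => k g * ((∫ v in (0 : ℝ)..g, k v) ^ n / n.factorial)) volume 0 1 := by
  refine hk.mul_continuousOn ?_
  rw [uIcc_of_le zero_le_one]
  have := (IsPrimitive.of_integral hk 0).continuousOn
  simp only [zero_add] at this
  exact (this.pow n).div_const _

/-- Grönwall's lemma with an integrable coefficient, in the case of zero initial value. -/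
theorem eq_zero_of_le_integral_mul {y k : ℝ → ℝ} (hk : IntervalIntegrable k volume 0 1)
    (hk0 : ∀ s ∈ Icc (0 : ℝ) 1, 0 ≤ k s) (hy : ContinuousOn y (Icc 0 1))
    (hy0 : ∀ s ∈ Icc (0 : ℝ) 1, 0 ≤ y s)
    (h : ∀ s ∈ Icc (0 : ℝ) 1, y s ≤ ∫ g in (0 : ℝ)..s, k g * y g) :
    ∀ s ∈ Icc (0 : ℝ) 1, y s = 0 := by
  obtain ⟨M, hM⟩ := isCompact_Icc.exists_bound_of_continuousOn hy
  have hky : IntervalIntegrable (fun g => k g * y g) volume 0 1 :=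
    hk.mul_continuousOn (by rwa [uIcc_of_le zero_le_one])
  have key : ∀ n : ℕ, ∀ s ∈ Icc (0 : ℝ) 1,
      y s ≤ M * ((∫ v in (0 : ℝ)..s, k v) ^ n / n.factorial) := by
    intro n
    induction n with
    | zero => intro s hs; simpa using (Real.le_norm_self _).trans (hM s hs)
    | succ n ih =>
      intro s hs
      refine (h s hs).trans ?_
      rw [← integral_mul_primitive_pow hk n hs, ← intervalIntegral.integral_const_mul]
      refine intervalIntegral.integral_mono_on hs.1 (hky.mono_unit (by simp) hs)
        (((intervalIntegrable_mul_primitive_pow hk n).const_mul M).mono_unit (by simp) hs) ?_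
      intro x hx
      have hx' : x ∈ Icc (0 : ℝ) 1 := ⟨hx.1, hx.2.trans hs.2⟩
      calc _ ≤ k x * (M * ((∫ v in (0 : ℝ)..x, k v) ^ n / n.factorial)) :=
            mul_le_mul_of_nonneg_left (ih x hx') (hk0 x hx')
        _ = _ := by ring
  intro s hs
  refine le_antisymm ?_ (hy0 s hs)
  have ht := (FloorSemiring.tendsto_pow_div_factorial_atTop (∫ v in (0 : ℝ)..s, k v)).const_mul M
  rw [mul_zero] at ht
  exact ge_of_tendsto' ht fun n => key n s hs

/-- A linear differential inequality with integrable coefficient and zero initial value forces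
the curve to vanish. -/
theorem IsPrimitive.eq_zero_of_norm_le {a α : ℝ → E} (h : IsPrimitive a α)
    {k : ℝ → ℝ} (hk : IntervalIntegrable k volume 0 1) (hk0 : ∀ s ∈ Icc (0 : ℝ) 1, 0 ≤ k s)
    (h0 : a 0 = 0) (hα : ∀ s ∈ Icc (0 : ℝ) 1, ‖α s‖ ≤ k s * ‖a s‖) :
    ∀ s ∈ Icc (0 : ℝ) 1, a s = 0 := by
  have := eq_zero_of_le_integral_mul hk hk0 h.continuousOn.norm (fun _ _ => norm_nonneg _) ?_
  · exact fun s hs => norm_eq_zero.1 (this s hs)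
  intro s hs
  rw [h.eq_integral s hs, h0, zero_add]
  have h1 : IntervalIntegrable (fun g => k g * ‖a g‖) volume 0 1 :=
    hk.mul_continuousOn (by rw [uIcc_of_le zero_le_one]; exact h.continuousOn.norm)
  refine intervalIntegral.norm_integral_le_of_norm_le hs.1 ?_ (h1.mono_unit (by simp) hs)
  filter_upwards with x hx
  exact hα x ⟨hx.1.le, hx.2.trans hs.2⟩

end Primitive

/-! ### The Dyson series -/

section Dyson

variable {E : Type*} [NormedAddCommGroup E] [NormedSpace ℂ E]
  {K : ℝ → E →L[ℂ] E}

lemma continuousOn_dysonTerm (hK : IntervalIntegrable K volume 0 1) (n : ℕ) :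
    ContinuousOn (dysonTerm K n) (Icc 0 1) := by
  induction n with
  | zero => exact continuousOn_const
  | succ n ih =>
    have h1 : IntervalIntegrable (fun g => K g * dysonTerm K n g) volume 0 1 :=
      hK.mul_continuousOn (by rwa [uIcc_of_le zero_le_one])
    have h2 := (IsPrimitive.of_integral h1 0).continuousOn
    simp only [zero_add] at h2
    exact h2.const_smul (-Complex.I)

lemma norm_dysonTerm_le (hK : IntervalIntegrable K volume 0 1) (n : ℕ) {s : ℝ}
    (hs : s ∈ Icc (0 : ℝ) 1) :
    ‖dysonTerm K n s‖ ≤ (∫ g in (0 : ℝ)..s, ‖K g‖) ^ n / n.factorial := by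
  induction n generalizing s with
  | zero =>
    simp only [dysonTerm, pow_zero, Nat.factorial_zero, Nat.cast_one, div_one]
    exact ContinuousLinearMap.norm_id_le
  | succ n ih =>
    rw [dysonTerm, norm_smul, norm_neg, Complex.norm_I, one_mul,
      ← integral_mul_primitive_pow hK.norm n hs]
    refine intervalIntegral.norm_integral_le_of_norm_le hs.1 ?_
      ((intervalIntegrable_mul_primitive_pow hK.norm n).mono_unit (by simp) hs)
    filter_upwards with x hx
    exact (norm_mul_le _ _).trans
      (mul_le_mul_of_nonneg_left (ih ⟨hx.1.le, hx.2.trans hs.2⟩) (norm_nonneg _))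

lemma integral_norm_le_of_mem (hK : IntervalIntegrable K volume 0 1) {s : ℝ}
    (hs : s ∈ Icc (0 : ℝ) 1) :
    0 ≤ (∫ g in (0 : ℝ)..s, ‖K g‖) ∧
      (∫ g in (0 : ℝ)..s, ‖K g‖) ≤ ∫ g in (0 : ℝ)..1, ‖K g‖ :=
  ⟨intervalIntegral.integral_nonneg hs.1 fun _ _ => norm_nonneg _,
    intervalIntegral.integral_mono_interval le_rfl hs.1 hs.2
      (Filter.Eventually.of_forall fun _ => norm_nonneg _) hK.norm⟩

lemma norm_dysonTerm_le' (hK : IntervalIntegrable K volume 0 1) (n : ℕ) {s : ℝ}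
    (hs : s ∈ Icc (0 : ℝ) 1) :
    ‖dysonTerm K n s‖ ≤ (∫ g in (0 : ℝ)..1, ‖K g‖) ^ n / n.factorial := by
  refine (norm_dysonTerm_le hK n hs).trans ?_
  obtain ⟨h1, h2⟩ := integral_norm_le_of_mem hK hs
  gcongr

theorem summable_dysonTerm [CompleteSpace E] (hK : IntervalIntegrable K volume 0 1) {s : ℝ}
    (hs : s ∈ Icc (0 : ℝ) 1) : Summable fun n => dysonTerm K n s :=
  Summable.of_norm_bounded (Real.summable_pow_div_factorial (∫ g in (0 : ℝ)..1, ‖K g‖))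
    fun n => norm_dysonTerm_le' hK n hs

lemma orderedExp_zero : orderedExp K 0 = 1 := by
  rw [orderedExp, tsum_eq_single 0]
  · rfl
  · intro n hn
    obtain ⟨m, rfl⟩ := Nat.exists_eq_succ_of_ne_zero hn
    simp [dysonTerm]

/-- The ordered exponential solves `U' = -i K U` in integral form. -/
theorem isPrimitive_orderedExp [CompleteSpace E] (hK : IntervalIntegrable K volume 0 1) :
    IsPrimitive (orderedExp K) (fun s => (-Complex.I) • (K s * orderedExp K s)) := by
  have hcont : ContinuousOn (orderedExp K) (Icc 0 1) :=
    continuousOn_tsum (continuousOn_dysonTerm hK)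
      (Real.summable_pow_div_factorial (∫ g in (0 : ℝ)..1, ‖K g‖))
      fun n x hx => norm_dysonTerm_le' hK n hx
  have hint : IntervalIntegrable (fun s => K s * orderedExp K s) volume 0 1 :=
    hK.mul_continuousOn (by rwa [uIcc_of_le zero_le_one])
  refine ⟨hint.smul (-Complex.I), fun s hs => ?_⟩
  have hs' : HasSum (fun n => ∫ g in (0 : ℝ)..s, K g * dysonTerm K n g)
      (∫ g in (0 : ℝ)..s, K g * orderedExp K g) := by
    refine intervalIntegral.hasSum_integral_of_dominated_convergence
      (fun n g => ‖K g‖ * ((∫ g in (0 : ℝ)..1, ‖K g‖) ^ n / n.factorial)) ?_ ?_ ?_ ?_ ?_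
    · intro n
      have : IntervalIntegrable (fun g => K g * dysonTerm K n g) volume 0 1 :=
        hK.mul_continuousOn (by
          rw [uIcc_of_le zero_le_one]; exact continuousOn_dysonTerm hK n)
      have h0 := this.mono_unit (x := 0) (by simp) hs
      rw [intervalIntegrable_iff] at h0
      exact h0.1
    · intro n
      filter_upwards with x hx
      rw [uIoc_of_le hs.1] at hx
      exact (norm_mul_le _ _).trans (mul_le_mul_of_nonneg_left
        (norm_dysonTerm_le' hK n ⟨hx.1.le, hx.2.trans hs.2⟩) (norm_nonneg _))
    · filter_upwards with x hx
      exact (Real.summable_pow_div_factorial _).mul_left _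
    · simp_rw [tsum_mul_left]
      exact (hK.norm.mul_const _).mono_unit (by simp) hs
    · filter_upwards with x hx
      rw [uIoc_of_le hs.1] at hx
      exact (summable_dysonTerm hK ⟨hx.1.le, hx.2.trans hs.2⟩).hasSum.mul_left _
  rw [orderedExp_zero, orderedExp, (summable_dysonTerm hK hs).tsum_eq_zero_add,
    intervalIntegral.integral_smul, ← hs'.tsum_eq, ← hs'.summable.tsum_const_smul]
  rfl

end Dyson

/-! ### Filter functions -/

open scoped FourierTransform in
lemma timeFourier_eq_fourier (F : ℝ → ℂ) (w : ℝ) :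
    timeFourier F w = 𝓕 F (-(w / (2 * Real.pi))) := by
  rw [timeFourier, Real.fourier_real_eq_integral_exp_smul]
  refine integral_congr_ae (Filter.Eventually.of_forall fun t => ?_)
  simp only [smul_eq_mul]
  rw [mul_comm]
  congr 2
  have : -2 * Real.pi * t * -(w / (2 * Real.pi)) = w * t := by
    field_simp
  rw [this]
  push_cast
  ring

lemma integrable_mul_exp {F : ℝ → ℂ} (hF : Integrable F) (w : ℝ) :
    Integrable fun t : ℝ => F t * Complex.exp (Complex.I * w * t) := by
  refine hF.mul_bdd (c := 1) (by fun_prop) (Filter.Eventually.of_forall fun t => ?_)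
  rw [show Complex.I * w * t = ((w * t : ℝ) : ℂ) * Complex.I by push_cast; ring,
    Complex.norm_exp_ofReal_mul_I]

/-- The Fourier transform of a function with finite moments is smooth. -/
lemma contDiff_timeFourier {F : ℝ → ℂ} (hF : ∀ n : ℕ, Integrable fun t => |t| ^ n * ‖F t‖) :
    ContDiff ℝ ∞ (timeFourier F) := by
  have h := Real.contDiff_fourier (f := F) (N := ⊤) fun n _ => by simpa using hF n
  have h2 : ContDiff ℝ ∞ fun w : ℝ => -(w / (2 * Real.pi)) := by fun_prop
  have : timeFourier F = _ := funext (timeFourier_eq_fourier F)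
  rw [this]
  exact h.comp h2

section Tail

variable {p : ℝ → ℝ}

/-- The tail integral `∫_t^∞ p` of a function on the line. -/
noncomputable def tailIntegral (p : ℝ → ℝ) (t : ℝ) : ℝ := ∫ s in Ioi t, p s

lemma integrable_of_moments {F : Type*} [NormedAddCommGroup F] {p : ℝ → F}
    (hp : ∀ n : ℕ, Integrable fun t => |t| ^ n * ‖p t‖)
    (hm : AEStronglyMeasurable p volume) : Integrable p :=
  (integrable_norm_iff hm).1 (by simpa using hp 0)

lemma hasDerivAt_tailIntegral (hc : Continuous p) (hp : Integrable p) (t : ℝ) :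
    HasDerivAt (tailIntegral p) (-p t) t := by
  have h : tailIntegral p = fun t => tailIntegral p 0 - ∫ s in (0 : ℝ)..t, p s := by
    ext t
    have := intervalIntegral.integral_interval_add_Ioi (a := 0) (b := t) hp.integrableOn
      hp.integrableOn
    simp only [tailIntegral]
    linarith
  rw [h]
  exact (intervalIntegral.integral_hasDerivAt_right (hc.intervalIntegrable _ _)
    (hc.stronglyMeasurableAtFilter _ _) hc.continuousAt).const_sub _

/-- Chebyshev's inequality: the tail integral of a function with finite moments decays faster than
every power. -/
lemma pow_mul_abs_tailIntegral_le (hp : ∀ n : ℕ, Integrable fun t => |t| ^ n * ‖p t‖)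
    (hi : Integrable p) (n : ℕ) {t : ℝ} (ht : 0 ≤ t) :
    t ^ n * |tailIntegral p t| ≤ ∫ s, |s| ^ n * ‖p s‖ := by
  have h1 : |tailIntegral p t| ≤ ∫ s in Ioi t, ‖p s‖ :=
    norm_integral_le_integral_norm (μ := volume.restrict (Ioi t)) p
  calc t ^ n * |tailIntegral p t| ≤ t ^ n * ∫ s in Ioi t, ‖p s‖ := by gcongr
    _ = ∫ s in Ioi t, t ^ n * ‖p s‖ := (integral_const_mul _ _).symm
    _ ≤ ∫ s in Ioi t, |s| ^ n * ‖p s‖ := by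
        refine setIntegral_mono_on (hi.norm.const_mul _).integrableOn (hp n).integrableOn
          measurableSet_Ioi fun s hs => ?_
        have hs' : t ≤ |s| := (le_of_lt hs).trans (le_abs_self s)
        gcongr
    _ ≤ _ := setIntegral_le_integral (hp n) (Filter.Eventually.of_forall fun s => by positivity)

/-- The odd, purely imaginary function equal to `i ∫_t^∞ p` for `t > 0`. -/
noncomputable def oddTail (p : ℝ → ℝ) (t : ℝ) : ℂ :=
  Complex.I * ((Real.sign t * tailIntegral p |t| : ℝ) : ℂ)

lemma oddTail_re (t : ℝ) : (oddTail p t).re = 0 := by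
  rw [oddTail, Complex.re_mul_ofReal]; simp

lemma oddTail_odd (t : ℝ) : oddTail p t = -oddTail p (-t) := by
  simp [oddTail, Real.sign_neg]

lemma abs_sign_le_one (t : ℝ) : |Real.sign t| ≤ 1 := by
  rcases Real.sign_apply_eq t with h | h | h <;> simp [h]

lemma norm_oddTail_le (t : ℝ) : ‖oddTail p t‖ ≤ |tailIntegral p (|t|)| := by
  rw [oddTail, norm_mul, Complex.norm_I, one_mul, Complex.norm_real, Real.norm_eq_abs, abs_mul]
  exact mul_le_of_le_one_left (abs_nonneg _) (abs_sign_le_one t)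

lemma measurable_oddTail (hc : Continuous p) (hi : Integrable p) : Measurable (oddTail p) := by
  have h1 : Continuous (tailIntegral p) :=
    continuous_iff_continuousAt.2 fun t => (hasDerivAt_tailIntegral hc hi t).continuousAt
  have h2 : Measurable Real.sign := by
    unfold Real.sign
    exact Measurable.ite measurableSet_Iio measurable_const
      (Measurable.ite measurableSet_Ioi measurable_const measurable_const)
  have h3 : Measurable fun t : ℝ => tailIntegral p |t| := (h1.comp continuous_abs).measurable
  exact (Complex.measurable_ofReal.comp (h2.mul h3)).const_mul _

lemma integrable_pow_mul_oddTail (hc : Continuous p)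
    (hp : ∀ n : ℕ, Integrable fun t => |t| ^ n * ‖p t‖) (n : ℕ) :
    Integrable fun t => |t| ^ n * ‖oddTail p t‖ := by
  have hi : Integrable p := integrable_of_moments hp hc.aestronglyMeasurable
  refine Integrable.mono' (integrable_inv_one_add_sq.const_mul
    ((∫ s, |s| ^ n * ‖p s‖) + ∫ s, |s| ^ (n + 2) * ‖p s‖)) ?_ ?_
  · exact ((continuous_abs.pow n).measurable.mul
      (measurable_oddTail hc hi).norm).aestronglyMeasurable
  · refine Filter.Eventually.of_forall fun t => ?_
    rw [Real.norm_of_nonneg (by positivity), ← div_eq_mul_inv, le_div_iff₀ (by positivity)]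
    have h1 := pow_mul_abs_tailIntegral_le hp hi n (abs_nonneg t)
    have h2 := pow_mul_abs_tailIntegral_le hp hi (n + 2) (abs_nonneg t)
    have h3 := norm_oddTail_le (p := p) t
    calc |t| ^ n * ‖oddTail p t‖ * (1 + t ^ 2)
        ≤ |t| ^ n * |tailIntegral p (|t|)| * (1 + |t| ^ 2) := by rw [sq_abs]; gcongr
      _ = |t| ^ n * |tailIntegral p (|t|)| + |t| ^ (n + 2) * |tailIntegral p (|t|)| := by ring
      _ ≤ _ := add_le_add h1 h2

/-- Integration by parts computes the sine transform of the tail integral. -/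
lemma integral_tailIntegral_mul_sin (hc : Continuous p) (heven : ∀ t, p (-t) = p t)
    (hp : ∀ n : ℕ, Integrable fun t => |t| ^ n * ‖p t‖) {w : ℝ} (hw : w ≠ 0) :
    2 * ∫ t in Ioi (0 : ℝ), tailIntegral p t * Real.sin (w * t) =
      (∫ t, p t * (1 - Real.cos (w * t))) / w := by
  have hi : Integrable p := integrable_of_moments hp hc.aestronglyMeasurable
  have hcont : Continuous (tailIntegral p) :=
    continuous_iff_continuousAt.2 fun t => (hasDerivAt_tailIntegral hc hi t).continuousAt
  have hv : ∀ t : ℝ, HasDerivAt (fun t => (1 - Real.cos (w * t)) / w) (Real.sin (w * t)) t := by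
    intro t
    have h1 : HasDerivAt (fun t : ℝ => w * t) w t := by
      simpa using (hasDerivAt_id t).const_mul w
    have h2 := ((h1.cos).const_sub 1).div_const w
    have e : -(-Real.sin (w * t) * w) / w = Real.sin (w * t) := by field_simp
    rwa [e] at h2
  have hbound : ∀ t : ℝ, |(1 - Real.cos (w * t)) / w| ≤ 2 / |w| := by
    intro t
    rw [abs_div]
    gcongr
    rw [abs_le]
    constructor <;> linarith [Real.neg_one_le_cos (w * t), Real.cos_le_one (w * t)]
  have hGint : IntegrableOn (tailIntegral p) (Ioi 0) := by
    have h := integrable_pow_mul_oddTail hc hp 0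
    simp only [pow_zero, one_mul] at h
    refine h.integrableOn.mono' hcont.aestronglyMeasurable ?_
    filter_upwards [ae_restrict_mem measurableSet_Ioi] with t ht
    rw [oddTail, Real.sign_of_pos ht, abs_of_pos ht, norm_mul, Complex.norm_I, Complex.norm_real]
    simp
  have htend : Filter.Tendsto (tailIntegral p) Filter.atTop (nhds 0) := by
    have h1 : Filter.Tendsto (fun t : ℝ => (∫ s, |s| ^ 1 * ‖p s‖) * t⁻¹) Filter.atTop (nhds 0) := by
      have := (tendsto_inv_atTop_zero (𝕜 := ℝ)).const_mul (∫ s, |s| ^ 1 * ‖p s‖)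
      rwa [mul_zero] at this
    refine squeeze_zero_norm' ?_ h1
    filter_upwards [Filter.eventually_gt_atTop 0] with t ht
    have := pow_mul_abs_tailIntegral_le hp hi 1 ht.le
    rw [Real.norm_eq_abs, ← div_eq_mul_inv, le_div_iff₀ ht]
    linarith
  have hpart := integral_Ioi_mul_deriv_eq_deriv_mul (a := (0 : ℝ)) (a' := (0 : ℝ)) (b' := (0 : ℝ))
    (u := tailIntegral p) (u' := fun t => -p t) (v := fun t => (1 - Real.cos (w * t)) / w)
    (v' := fun t => Real.sin (w * t)) (fun t _ => hasDerivAt_tailIntegral hc hi t)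
    (fun t _ => hv t)
    (hGint.mul_bdd (c := 1) (by fun_prop) (Filter.Eventually.of_forall fun t => by
      simpa using Real.abs_sin_le_one (w * t)))
    (hi.neg.integrableOn.mul_bdd (c := 2 / |w|) (by fun_prop)
      (Filter.Eventually.of_forall hbound))
    (by
      have : Continuous (tailIntegral p * fun t => (1 - Real.cos (w * t)) / w) :=
        hcont.mul (by fun_prop)
      have := (this.tendsto 0).mono_left (nhdsWithin_le_nhds (s := Ioi 0))
      simpa using this)
    (by
      have h1 : Filter.Tendsto (fun t => |tailIntegral p t| * (2 / |w|)) Filter.atTop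
          (nhds 0) := by simpa using htend.abs.mul_const (2 / |w|)
      refine squeeze_zero_norm (fun t => ?_) h1
      rw [Pi.mul_apply, norm_mul, Real.norm_eq_abs, Real.norm_eq_abs]
      gcongr
      exact hbound t)
  have habs : ∀ t : ℝ, p |t| * (1 - Real.cos (w * |t|)) = p t * (1 - Real.cos (w * t)) := by
    intro t
    rcases abs_choice t with h | h
    · rw [h]
    · rw [h, heven, mul_neg, Real.cos_neg]
  have h2 := integral_comp_abs (f := fun t => p t * (1 - Real.cos (w * t)))
  simp only [habs] at h2
  rw [hpart, h2, sub_zero, zero_sub, ← integral_neg, mul_div_assoc, ← integral_div]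
  congr 2
  ext t
  ring

/-- Where the cosine transform of `p` vanishes, the right-hand side is `-(∫ p) / w`. -/
lemma timeFourier_oddTail (hc : Continuous p) (heven : ∀ t, p (-t) = p t)
    (hp : ∀ n : ℕ, Integrable fun t => |t| ^ n * ‖p t‖) {w : ℝ} (hw : w ≠ 0) :
    timeFourier (oddTail p) w = -((((∫ t, p t * (1 - Real.cos (w * t))) / w : ℝ)) : ℂ) := by
  have hi : Integrable p := integrable_of_moments hp hc.aestronglyMeasurable
  have hF : Integrable (oddTail p) := integrable_of_moments (integrable_pow_mul_oddTail hc hp)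
    (measurable_oddTail hc hi).aestronglyMeasurable
  have h1 : timeFourier (oddTail p) w =
      ∫ t : ℝ, -(oddTail p t * Complex.exp (Complex.I * ((-w : ℝ) : ℂ) * t)) := by
    rw [timeFourier, ← integral_neg_eq_self]
    refine integral_congr_ae (Filter.Eventually.of_forall fun t => ?_)
    simp only
    rw [oddTail_odd t]
    push_cast
    ring_nf
  have h2 : 2 * timeFourier (oddTail p) w =
      ∫ t : ℝ, ((-2 * (tailIntegral p |t| * Real.sin (w * |t|)) : ℝ) : ℂ) := by
    rw [two_mul]
    nth_rw 2 [h1]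
    have hneg : Integrable fun t : ℝ =>
        -(oddTail p t * Complex.exp (Complex.I * ((-w : ℝ) : ℂ) * t)) :=
      (integrable_mul_exp hF (-w)).neg
    rw [timeFourier, ← integral_add (integrable_mul_exp hF w) hneg]
    refine integral_congr_ae (Filter.Eventually.of_forall fun t => ?_)
    simp only
    have e1 : Complex.exp (Complex.I * w * t) =
        Complex.cos ((w * t : ℝ) : ℂ) + Complex.sin ((w * t : ℝ) : ℂ) * Complex.I := by
      rw [← Complex.exp_mul_I]; congr 1; push_cast; ring
    have e2 : Complex.exp (Complex.I * ((-w : ℝ) : ℂ) * t) =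
        Complex.cos ((w * t : ℝ) : ℂ) - Complex.sin ((w * t : ℝ) : ℂ) * Complex.I := by
      have : Complex.I * ((-w : ℝ) : ℂ) * t = (-((w * t : ℝ) : ℂ)) * Complex.I := by
        push_cast; ring
      rw [this, Complex.exp_mul_I, Complex.cos_neg, Complex.sin_neg]; ring
    have e3 : Real.sign t * Real.sin (w * t) = Real.sin (w * |t|) := by
      rcases lt_trichotomy t 0 with h | h | h
      · rw [Real.sign_of_neg h, abs_of_neg h, mul_neg, Real.sin_neg]; ring
      · simp [h]
      · rw [Real.sign_of_pos h, abs_of_pos h]; ring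
    rw [e1, e2, ← e3, oddTail]
    push_cast
    linear_combination (2 * (Real.sign t : ℂ) * (tailIntegral p |t| : ℂ) *
      Complex.sin (w * t)) * Complex.I_mul_I
  rw [integral_complex_ofReal, integral_comp_abs (f := fun t =>
    -2 * (tailIntegral p t * Real.sin (w * t))), integral_const_mul] at h2
  have h3 := integral_tailIntegral_mul_sin hc heven hp hw
  have h4 : (2 : ℂ) * timeFourier (oddTail p) w =
      2 * -((((∫ t, p t * (1 - Real.cos (w * t))) / w : ℝ)) : ℂ) := by
    rw [h2, ← h3]
    push_cast
    ring
  exact mul_left_cancel₀ two_ne_zero h4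

end Tail

open scoped FourierTransform in
/-- A rapidly decreasing even function whose cosine transform is a bump function around zero. -/
lemma exists_even_cosineTransform {Δ : ℝ} (hΔ : 0 < Δ) : ∃ p : ℝ → ℝ, Continuous p ∧
    (∀ t, p (-t) = p t) ∧ (∀ n : ℕ, Integrable fun t => |t| ^ n * ‖p t‖) ∧
    ∀ w, Δ < |w| → ∫ t, p t * (1 - Real.cos (w * t)) = 1 := by
  have hπ : 0 < 2 * Real.pi := Real.two_pi_pos
  have hr : 0 < Δ / (2 * Real.pi) := by positivity
  let b : ContDiffBump (0 : ℝ) := ⟨Δ / (2 * Real.pi) / 2, Δ / (2 * Real.pi), half_pos hr,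
    half_lt_self hr⟩
  have hb1 : HasCompactSupport (fun v => ((b v : ℝ) : ℂ)) :=
    b.hasCompactSupport.comp_left (g := fun x : ℝ => (x : ℂ)) (by simp)
  have hb2 : ContDiff ℝ ∞ (fun v => ((b v : ℝ) : ℂ)) :=
    Complex.ofRealCLM.contDiff.comp b.contDiff
  let φ : SchwartzMap ℝ ℂ := hb1.toSchwartzMap hb2
  have hφ : ∀ v, φ v = ((b v : ℝ) : ℂ) := fun v => rfl
  let q : SchwartzMap ℝ ℂ := 𝓕 φ
  have hq : 𝓕⁻ q = φ := FourierTransform.fourierInv_fourier_eq φ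
  have heven : ∀ t, q (-t) = q t := by
    intro t
    have h1 : q (-t) = 𝓕⁻ (φ : ℝ → ℂ) t := (Real.fourierInv_eq_fourier_neg _ t).symm
    have h2 : (fun x => φ (-x)) = (φ : ℝ → ℂ) := by
      ext x; rw [hφ, hφ, b.neg]
    rw [h1, Real.fourierInv_eq_fourier_comp_neg, h2]
    rfl
  have hFT : ∀ w : ℝ, ∫ t : ℝ, Complex.exp (((w * t : ℝ) : ℂ) * Complex.I) * q t =
      φ (w / (2 * Real.pi)) := by
    intro w
    rw [← hq, SchwartzMap.fourierInv_coe, Real.fourierInv_eq']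
    refine integral_congr_ae (Filter.Eventually.of_forall fun t => ?_)
    simp only [smul_eq_mul]
    congr 3
    simp
    field_simp
  refine ⟨fun t => (q t).re, Complex.continuous_re.comp q.continuous, fun t => ?_, fun n => ?_,
    fun w hw => ?_⟩
  · simp only [heven]
  · refine (q.integrable_pow_mul volume n).mono' ?_ ?_
    · exact ((continuous_abs.pow n).mul
        (Complex.continuous_re.comp q.continuous).norm).aestronglyMeasurable
    · refine Filter.Eventually.of_forall fun t => ?_
      rw [Real.norm_of_nonneg (by positivity), Real.norm_eq_abs t]
      gcongr
      exact Complex.abs_re_le_norm _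
  · have hint : ∀ w : ℝ, Integrable fun t : ℝ =>
        Complex.exp (((w * t : ℝ) : ℂ) * Complex.I) * q t := by
      intro w
      refine (q.integrable (μ := volume)).bdd_mul (c := 1) (by fun_prop)
        (Filter.Eventually.of_forall fun t => ?_)
      rw [Complex.norm_exp_ofReal_mul_I]
    have h0 := hFT 0
    have h1 := hFT w
    have h2 := hFT (-w)
    have z : ∀ v : ℝ, Δ < |v| → φ (v / (2 * Real.pi)) = 0 := by
      intro v hv
      rw [hφ, b.zero_of_le_dist, Complex.ofReal_zero]
      rw [Real.dist_eq, sub_zero, abs_div, abs_of_pos hπ]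
      exact div_le_div_of_nonneg_right hv.le hπ.le
    rw [z w hw] at h1
    rw [z (-w) (by rwa [abs_neg])] at h2
    have e0 : φ (0 / (2 * Real.pi)) = 1 := by
      rw [hφ, zero_div, b.one_of_mem_closedBall, Complex.ofReal_one]
      simpa using b.rIn_pos.le
    rw [e0] at h0
    have hadd : Integrable fun t : ℝ => Complex.exp (((w * t : ℝ) : ℂ) * Complex.I) * q t +
        Complex.exp (((-w * t : ℝ) : ℂ) * Complex.I) * q t := (hint w).add (hint (-w))
    have hsub : Integrable fun t : ℝ => Complex.exp (((0 * t : ℝ) : ℂ) * Complex.I) * q t -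
        (1 / 2 : ℂ) * (Complex.exp (((w * t : ℝ) : ℂ) * Complex.I) * q t +
        Complex.exp (((-w * t : ℝ) : ℂ) * Complex.I) * q t) :=
      (hint 0).sub (hadd.const_mul _)
    have h3 : ∫ t : ℝ, (Complex.exp (((0 * t : ℝ) : ℂ) * Complex.I) * q t -
        (1 / 2 : ℂ) * (Complex.exp (((w * t : ℝ) : ℂ) * Complex.I) * q t +
        Complex.exp (((-w * t : ℝ) : ℂ) * Complex.I) * q t)) = 1 := by
      rw [integral_sub (hint 0) (hadd.const_mul _), integral_const_mul,
        integral_add (hint w) (hint (-w)), h0, h1, h2]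
      simp
    have h4 := congrArg Complex.re h3
    rw [← Complex.reCLM_apply, ← ContinuousLinearMap.integral_comp_comm _ hsub] at h4
    rw [Complex.one_re] at h4
    refine Eq.trans (integral_congr_ae (Filter.Eventually.of_forall fun t => ?_)) h4
    simp only [Complex.reCLM_apply]
    have e1 : Complex.exp (((w * t : ℝ) : ℂ) * Complex.I) +
        Complex.exp (((-w * t : ℝ) : ℂ) * Complex.I) = 2 * ((Real.cos (w * t) : ℝ) : ℂ) := by
      rw [Complex.ofReal_cos, Complex.two_cos]
      push_cast
      ring_nf
    rw [← add_mul, e1]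
    have e2 : Complex.exp (((0 * t : ℝ) : ℂ) * Complex.I) * q t -
        1 / 2 * (2 * ((Real.cos (w * t) : ℝ) : ℂ) * q t) =
        ((1 - Real.cos (w * t) : ℝ) : ℂ) * q t := by
      simp
      ring
    rw [e2, Complex.re_ofReal_mul, mul_comm]

/-- There is a purely imaginary filter function all of whose moments are finite. -/
theorem exists_filterFunction {Δ : ℝ} (hΔ : 0 < Δ) : ∃ F : ℝ → ℂ, IsFilterFunction Δ F ∧
    (∀ t, (F t).re = 0) ∧ ∀ n : ℕ, Integrable fun t => |t| ^ n * ‖F t‖ := by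
  obtain ⟨p, hc, heven, hp, hcos⟩ := exists_even_cosineTransform hΔ
  have hF := integrable_pow_mul_oddTail hc hp
  refine ⟨oddTail p, ⟨integrable_of_moments hF (measurable_oddTail hc
    (integrable_of_moments hp hc.aestronglyMeasurable)).aestronglyMeasurable, fun w hw => ?_,
    contDiff_timeFourier hF, oddTail_odd⟩, oddTail_re, hF⟩
  have hw0 : w ≠ 0 := by
    rintro rfl
    rw [abs_zero] at hw
    exact hΔ.not_gt hw
  rw [timeFourier_oddTail hc heven hp hw0, hcos w hw]
  push_cast
  ring

open scoped FourierTransform in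
/-- An integrable function with smooth, compactly supported Fourier transform agrees almost
everywhere with a Schwartz function. -/
lemma exists_schwartz_ae_eq {f : ℝ → ℂ} (hf : Integrable f) (h1 : HasCompactSupport (𝓕 f))
    (h2 : ContDiff ℝ ∞ (𝓕 f)) : ∃ ψ : SchwartzMap ℝ ℂ, f =ᵐ[volume] ψ := by
  let φ : SchwartzMap ℝ ℂ := h1.toSchwartzMap h2
  refine ⟨(𝓕⁻ φ : SchwartzMap ℝ ℂ), ?_⟩
  refine ae_eq_of_integral_contDiff_smul_eq hf.locallyIntegrable
    ((𝓕⁻ φ).integrable (μ := volume)).locallyIntegrable fun g hg hgc => ?_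
  have hg1 : HasCompactSupport (fun v => ((g v : ℝ) : ℂ)) :=
    hgc.comp_left (g := fun x : ℝ => (x : ℂ)) (by simp)
  have hg2 : ContDiff ℝ ∞ (fun v => ((g v : ℝ) : ℂ)) := Complex.ofRealCLM.contDiff.comp hg
  let γ : SchwartzMap ℝ ℂ := 𝓕⁻ (hg1.toSchwartzMap hg2)
  have hγ : ∀ v, 𝓕 γ v = ((g v : ℝ) : ℂ) := by
    intro v
    have : 𝓕 γ = hg1.toSchwartzMap hg2 := FourierTransform.fourier_fourierInv_eq _
    rw [this]
    rfl
  calc ∫ x, g x • f x = ∫ x, 𝓕 (γ : ℝ → ℂ) x • f x := by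
        refine integral_congr_ae (Filter.Eventually.of_forall fun t => ?_)
        have := hγ t
        rw [SchwartzMap.fourier_coe] at this
        simp only [this, Complex.real_smul, smul_eq_mul]
    _ = ∫ x, γ x • 𝓕 f x := by
        simpa using! VectorFourier.integral_fourierIntegral_smul_eq_flip (L := innerₗ ℝ)
          Real.continuous_fourierChar continuous_inner γ.integrable hf
    _ = ∫ x, γ x • 𝓕 (𝓕⁻ φ) x := by
        have : 𝓕 (𝓕⁻ φ) = φ := FourierTransform.fourier_fourierInv_eq _
        rw [this]
        rfl
    _ = ∫ x, (𝓕 γ) x • (𝓕⁻ φ) x := (SchwartzMap.integral_fourier_smul_eq γ (𝓕⁻ φ)).symm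
    _ = ∫ x, g x • (𝓕⁻ φ : SchwartzMap ℝ ℂ) x := by
        refine integral_congr_ae (Filter.Eventually.of_forall fun t => ?_)
        simp only [hγ t, Complex.real_smul, smul_eq_mul]

open scoped FourierTransform in
/-- Every filter function has finite moments, because two filter functions for the same gap differ
by a Schwartz function. -/
theorem IsFilterFunction.integrable_pow_mul {Δ : ℝ} (hΔ : 0 < Δ) {F : ℝ → ℂ}
    (hF : IsFilterFunction Δ F) (n : ℕ) : Integrable fun t => |t| ^ n * ‖F t‖ := by
  obtain ⟨F₀, hF₀, -, hmom⟩ := exists_filterFunction hΔ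
  have hπ : 0 < 2 * Real.pi := Real.two_pi_pos
  have hfour : ∀ v, 𝓕 (F - F₀) v =
      timeFourier F (-(2 * Real.pi * v)) - timeFourier F₀ (-(2 * Real.pi * v)) := by
    intro v
    have e : ∀ G : ℝ → ℂ, timeFourier G (-(2 * Real.pi * v)) = 𝓕 G v := by
      intro G
      rw [timeFourier_eq_fourier]
      field_simp
    rw [e, e, Real.fourier_eq, Real.fourier_eq, Real.fourier_eq, ← integral_sub]
    · simp [smul_sub]
    · exact (Real.fourierIntegral_convergent_iff v).2 hF.integrable
    · exact (Real.fourierIntegral_convergent_iff v).2 hF₀.integrable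
  obtain ⟨ψ, hψ⟩ := exists_schwartz_ae_eq (hF.integrable.sub hF₀.integrable)
    (HasCompactSupport.intro (isCompact_Icc (a := -(Δ / (2 * Real.pi)))
      (b := Δ / (2 * Real.pi))) fun v hv => by
        have hv' : Δ < |-(2 * Real.pi * v)| := by
          rw [abs_neg, abs_mul, abs_of_pos hπ]
          rw [mem_Icc, ← abs_le, not_le, div_lt_iff₀ hπ] at hv
          linarith
        rw [hfour, hF.fourier_eq _ hv', hF₀.fourier_eq _ hv', sub_self])
    (by
      have : 𝓕 (F - F₀) = _ := funext hfour
      rw [this]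
      have h2 : ContDiff ℝ ∞ fun v : ℝ => -(2 * Real.pi * v) := by fun_prop
      exact (hF.fourier_smooth.comp h2).sub (hF₀.fourier_smooth.comp h2))
  refine ((ψ.integrable_pow_mul volume n).add (hmom n)).mono' ?_ ?_
  · exact (continuous_abs.pow n).aestronglyMeasurable.mul hF.integrable.1.norm
  · filter_upwards [hψ] with t ht
    rw [Real.norm_of_nonneg (by positivity), Pi.add_apply, Real.norm_eq_abs t, ← mul_add]
    gcongr
    rw [← ht, Pi.sub_apply]
    simpa using norm_add_le (F t - F₀ t) (F₀ t)

/-! ### Heisenberg evolution in a C⋆-algebra -/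

section Heisenberg

/-- The one-parameter group `t ↦ e^{iHt}`. -/
noncomputable def phaseExp {𝔸 : Type*} [NormedRing 𝔸] [NormedAlgebra ℂ 𝔸] (H : 𝔸) (t : ℝ) : 𝔸 :=
  NormedSpace.exp ((Complex.I * (t : ℂ)) • H)

/-- The Heisenberg evolution `e^{iHt} A e^{-iHt}`. -/
noncomputable def heisenberg {𝔸 : Type*} [NormedRing 𝔸] [NormedAlgebra ℂ 𝔸] (H : 𝔸) (t : ℝ)
    (A : 𝔸) : 𝔸 :=
  phaseExp H t * A * phaseExp H (-t)

section Banach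

variable {𝔸 : Type*} [NormedRing 𝔸] [NormedAlgebra ℂ 𝔸]

lemma phaseExp_eq (H : 𝔸) (t : ℝ) :
    phaseExp H t = NormedSpace.exp (t • (Complex.I • H)) := by
  rw [phaseExp, mul_comm, mul_smul, Complex.coe_smul]

@[simp] lemma phaseExp_zero (H : 𝔸) : phaseExp H 0 = 1 := by
  simp [phaseExp]

lemma phaseExp_neg (H : 𝔸) (t : ℝ) : phaseExp (-H) t = phaseExp H (-t) := by
  simp [phaseExp]

lemma heisenberg_neg (H : 𝔸) (t : ℝ) (A : 𝔸) :
    heisenberg (-H) t A = heisenberg H (-t) A := by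
  simp only [heisenberg, phaseExp_neg]

lemma Commute.phaseExp_right {A H : 𝔸} (h : Commute A H) (t : ℝ) : Commute A (phaseExp H t) :=
  (h.smul_right _).exp_right

variable [CompleteSpace 𝔸]

lemma phaseExp_mul_neg (H : 𝔸) (t : ℝ) : phaseExp H t * phaseExp H (-t) = 1 := by
  let +nondep : NormedAlgebra ℚ 𝔸 := .restrictScalars ℚ ℂ 𝔸
  rw [phaseExp, phaseExp, ← NormedSpace.exp_add_of_commute]
  · simp
  · exact ((Commute.refl H).smul_left _).smul_right _

lemma phaseExp_neg_mul (H : 𝔸) (t : ℝ) : phaseExp H (-t) * phaseExp H t = 1 := by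
  simpa using phaseExp_mul_neg H (-t)

lemma hasDerivAt_phaseExp (H : 𝔸) (t : ℝ) :
    HasDerivAt (phaseExp H) (Complex.I • (H * phaseExp H t)) t := by
  have h := hasDerivAt_exp_smul_const' (𝕂 := ℝ) (Complex.I • H) t
  rw [← phaseExp_eq, smul_mul_assoc] at h
  exact h.congr_of_eventuallyEq (Filter.Eventually.of_forall fun s => phaseExp_eq H s)

lemma hasDerivAt_phaseExp_neg (H : 𝔸) (t : ℝ) :
    HasDerivAt (fun s => phaseExp H (-s)) (-(Complex.I • (H * phaseExp H (-t)))) t := by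
  have h := (hasDerivAt_phaseExp H (-t)).scomp t (hasDerivAt_neg t)
  simpa using! h

lemma continuous_phaseExp (H : 𝔸) : Continuous (phaseExp H) :=
  continuous_iff_continuousAt.2 fun t => (hasDerivAt_phaseExp H t).continuousAt

lemma continuous_heisenberg (H A : 𝔸) : Continuous fun t => heisenberg H t A :=
  ((continuous_phaseExp H).mul continuous_const).mul
    ((continuous_phaseExp H).comp continuous_neg)

end Banach

variable {𝔸 : Type*} [CStarAlgebra 𝔸]

lemma star_phaseExp {H : 𝔸} (hH : IsSelfAdjoint H) (t : ℝ) :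
    star (phaseExp H t) = phaseExp H (-t) := by
  rw [phaseExp, phaseExp, NormedSpace.star_exp, star_smul, hH.star_eq]
  simp

lemma phaseExp_mem_unitary {H : 𝔸} (hH : IsSelfAdjoint H) (t : ℝ) : phaseExp H t ∈ unitary 𝔸 := by
  rw [Unitary.mem_iff, star_phaseExp hH]
  exact ⟨phaseExp_neg_mul H t, phaseExp_mul_neg H t⟩

lemma norm_heisenberg {H : 𝔸} (hH : IsSelfAdjoint H) (t : ℝ) (A : 𝔸) :
    ‖heisenberg H t A‖ = ‖A‖ := by
  rw [heisenberg, CStarRing.norm_mul_mem_unitary _ (phaseExp_mem_unitary hH _),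
    CStarRing.norm_mem_unitary_mul _ (phaseExp_mem_unitary hH _)]

lemma star_heisenberg {H : 𝔸} (hH : IsSelfAdjoint H) (t : ℝ) (A : 𝔸) :
    star (heisenberg H t A) = heisenberg H t (star A) := by
  simp only [heisenberg, star_mul, star_phaseExp hH, neg_neg, mul_assoc]

/-- Conjugation by `e^{iHt}` moves the time evolution to the other entry of a commutator. -/
lemma commutator_heisenberg (H A O : 𝔸) (t : ℝ) :
    heisenberg H t A * O - O * heisenberg H t A =
      heisenberg H t (A * heisenberg H (-t) O - heisenberg H (-t) O * A) := by
  have h1 := phaseExp_mul_neg H t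
  simp only [heisenberg, neg_neg, mul_sub, sub_mul]
  congr 1
  · calc _ = phaseExp H t * A * phaseExp H (-t) * O * 1 := (mul_one _).symm
      _ = _ := by rw [← h1]; noncomm_ring
  · calc _ = 1 * O * (phaseExp H t * A * phaseExp H (-t)) := by noncomm_ring
      _ = _ := by rw [← h1]; noncomm_ring

lemma norm_commutator_heisenberg {H : 𝔸} (hH : IsSelfAdjoint H) (A O : 𝔸) (t : ℝ) :
    ‖heisenberg H t A * O - O * heisenberg H t A‖ =
      ‖A * heisenberg H (-t) O - heisenberg H (-t) O * A‖ := by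
  rw [commutator_heisenberg, norm_heisenberg hH]

lemma norm_commutator_le (A B : 𝔸) : ‖A * B - B * A‖ ≤ 2 * ‖A‖ * ‖B‖ := by
  calc ‖A * B - B * A‖ ≤ ‖A‖ * ‖B‖ + ‖B‖ * ‖A‖ :=
        (norm_sub_le _ _).trans (add_le_add (norm_mul_le _ _) (norm_mul_le _ _))
    _ = _ := by ring

/-- The integral inequality behind the Lieb–Robinson bound: if `R` commutes with `A`, then only
`H - R` makes `A` spread. In the interaction picture with respect to `R`, the observable `O` moves
with velocity `‖[(H - R)(s), O]‖`. -/
theorem norm_commutator_heisenberg_le {H R A O : 𝔸} (hH : IsSelfAdjoint H) (hR : IsSelfAdjoint R)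
    (hA : Commute A R) {b b' : ℝ → ℝ} (hb : ∀ s, HasDerivAt b (b' s) s) {t : ℝ} (ht : 0 ≤ t)
    (hbound : ∀ s, 0 ≤ s →
      ‖heisenberg H s (H - R) * O - O * heisenberg H s (H - R)‖ ≤ b' s) :
    ‖heisenberg H t A * O - O * heisenberg H t A‖ ≤
      ‖A * O - O * A‖ + 2 * ‖A‖ * (b t - b 0) := by
  -- the evolved observable in the interaction picture
  set y : ℝ → 𝔸 := fun s => heisenberg R s (heisenberg H (-s) O) with hy
  have hyder : ∀ s, HasDerivAt y
      (-(Complex.I • heisenberg R s ((H - R) * heisenberg H (-s) O -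
        heisenberg H (-s) O * (H - R)))) s := by
    intro s
    have d := ((hasDerivAt_phaseExp R s).mul (((hasDerivAt_phaseExp_neg H s).mul_const O).mul
      (hasDerivAt_phaseExp H s))).mul (hasDerivAt_phaseExp_neg R s)
    have c1 : Commute R (phaseExp R s) := (Commute.refl R).phaseExp_right s
    have c2 : Commute H (phaseExp H s) := (Commute.refl H).phaseExp_right s
    have e : y = ((phaseExp R * (((fun s => phaseExp H (-s)) * fun _ => O) * phaseExp H)) *
        fun s => phaseExp R (-s)) := by
      ext s
      simp only [hy, heisenberg, Pi.mul_apply, neg_neg]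
    rw [e]
    refine d.congr_deriv ?_
    simp only [heisenberg, neg_neg, c1.eq, Pi.mul_apply, smul_mul_assoc, mul_smul_comm, neg_mul,
      mul_neg, mul_add, add_mul, mul_sub, sub_mul, smul_sub, mul_assoc]
    rw [← mul_assoc H (phaseExp H s), c2.eq, mul_assoc]
    abel
  have hnorm : ∀ s, 0 ≤ s → ‖-(Complex.I • heisenberg R s ((H - R) * heisenberg H (-s) O -
        heisenberg H (-s) O * (H - R)))‖ ≤ b' s := by
    intro s hs
    rw [norm_neg, norm_smul, Complex.norm_I, one_mul, norm_heisenberg hR,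
      ← norm_commutator_heisenberg hH]
    exact hbound s hs
  have hdist : ‖y t - O‖ ≤ b t - b 0 := by
    refine image_norm_le_of_norm_deriv_right_le_deriv_boundary (a := 0) (b := t)
      (f := fun s => y s - O) (B := fun s => b s - b 0) (B' := b') ?_
      (fun s _ => ((hyder s).sub_const O).hasDerivWithinAt) ?_ (fun s => (hb s).sub_const _)
      (fun s hs => hnorm s hs.1) ⟨ht, le_rfl⟩
    · exact fun s _ => ((hyder s).continuousAt.sub continuousAt_const).continuousWithinAt
    · simp [hy, heisenberg]
  have key : ‖heisenberg H t A * O - O * heisenberg H t A‖ = ‖A * y t - y t * A‖ := by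
    have h1 := norm_commutator_heisenberg hR A (heisenberg H (-t) O) (-t)
    have hcomm' : heisenberg R (-t) A = A := by
      rw [heisenberg, ← (hA.phaseExp_right (-t)).eq, mul_assoc, phaseExp_mul_neg, mul_one]
    rw [hcomm', neg_neg] at h1
    rw [norm_commutator_heisenberg hH, h1]
  rw [key]
  calc ‖A * y t - y t * A‖ = ‖(A * O - O * A) + (A * (y t - O) - (y t - O) * A)‖ := by
        congr 1; noncomm_ring
    _ ≤ ‖A * O - O * A‖ + 2 * ‖A‖ * ‖y t - O‖ :=
        (norm_add_le _ _).trans (add_le_add_right (norm_commutator_le _ _) _)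
    _ ≤ _ := by gcongr

end Heisenberg

/-! ### Supports of operators -/

section Support

variable {Λ : Type*} [Fintype Λ] [DecidableEq Λ] {σ : Λ → Type*} [∀ x, Fintype (σ x)]
  [∀ x, DecidableEq (σ x)]

lemma Op.ext_single {A B : Op σ}
    (h : ∀ a b : ∀ x, σ x, A (EuclideanSpace.single b 1) a = B (EuclideanSpace.single b 1) a) :
    A = B := by
  refine ContinuousLinearMap.coe_injective
    ((EuclideanSpace.basisFun (∀ x, σ x) ℂ).toBasis.ext fun b => ?_)
  ext a
  simpa using h a b

lemma Op.mul_apply_single (A B : Op σ) (a b : ∀ x, σ x) :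
    (A * B) (EuclideanSpace.single b 1) a =
      ∑ c, A (EuclideanSpace.single c 1) a * B (EuclideanSpace.single b 1) c := by
  have h : B (EuclideanSpace.single b 1) =
      ∑ c, B (EuclideanSpace.single b 1) c • EuclideanSpace.single c (1 : ℂ) := by
    have := (EuclideanSpace.basisFun (∀ x, σ x) ℂ).sum_repr (B (EuclideanSpace.single b 1))
    simpa using this.symm
  rw [mul_apply_eq_comp]
  nth_rw 1 [h]
  rw [map_sum, WithLp.ofLp_sum, Finset.sum_apply]
  refine Finset.sum_congr rfl fun c _ => ?_
  rw [map_smul, PiLp.smul_apply, smul_eq_mul, mul_comm]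

/-- The operators supported on a region form a subspace. -/
def supportedSubmodule (σ : Λ → Type*) [∀ x, Fintype (σ x)] [∀ x, DecidableEq (σ x)]
    (Z : Finset Λ) : Submodule ℝ (Op σ) where
  carrier := {A | SupportedOn Z A}
  add_mem' := by
    rintro A B ⟨M, hM⟩ ⟨N, hN⟩
    refine ⟨M + N, fun a b => ?_⟩
    rw [add_apply, PiLp.add_apply, hM, hN]
    split_ifs <;> simp
  zero_mem' := ⟨0, fun a b => by simp⟩
  smul_mem' := by
    rintro c A ⟨M, hM⟩
    refine ⟨c • M, fun a b => ?_⟩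
    rw [smul_apply, PiLp.smul_apply, hM]
    split_ifs <;> simp

/-- The matrix of a product of operators with disjoint supports. -/
lemma mul_apply_single_of_disjoint {X Z : Finset Λ} (hXZ : Disjoint X Z) {A B : Op σ}
    {M : Matrix (∀ x : X, σ x) (∀ x : X, σ x) ℂ} {N : Matrix (∀ x : Z, σ x) (∀ x : Z, σ x) ℂ}
    (hM : ∀ a b : ∀ x, σ x, A (EuclideanSpace.single b 1) a =
      if ∀ x, x ∉ X → a x = b x then M (X.restrict a) (X.restrict b) else 0)
    (hN : ∀ a b : ∀ x, σ x, B (EuclideanSpace.single b 1) a =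
      if ∀ x, x ∉ Z → a x = b x then N (Z.restrict a) (Z.restrict b) else 0)
    (a b : ∀ x, σ x) :
    (A * B) (EuclideanSpace.single b 1) a =
      if ∀ x, x ∉ X ∪ Z → a x = b x then
        M (X.restrict a) (X.restrict b) * N (Z.restrict a) (Z.restrict b) else 0 := by
  rw [Op.mul_apply_single]
  -- the only intermediate configuration agrees with `b` on `X` and with `a` elsewhere
  set c₀ : ∀ x, σ x := fun x => if x ∈ X then b x else a x with hc₀
  have hZX : ∀ x ∈ Z, x ∉ X := fun x hz hx => Finset.disjoint_left.1 hXZ hx hz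
  rw [Finset.sum_eq_single c₀]
  · rw [hM, hN, if_pos fun x hx => by simp [hc₀, hx]]
    have e1 : X.restrict c₀ = X.restrict b := by
      ext x; simp [hc₀, Finset.restrict]
    have e2 : Z.restrict c₀ = Z.restrict a := by
      ext x; simp [hc₀, Finset.restrict, hZX x.1 x.2]
    rw [e1, e2]
    have e3 : (∀ x, x ∉ Z → c₀ x = b x) ↔ ∀ x, x ∉ X ∪ Z → a x = b x := by
      refine forall_congr' fun x => ?_
      by_cases hx : x ∈ X <;> simp [hc₀, hx]
    simp only [e3, mul_ite, mul_zero]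
  · intro c _ hc
    rw [hM, hN]
    split_ifs with h1 h2
    · refine absurd (funext fun x => ?_) hc
      by_cases hx : x ∈ X
      · simp only [hc₀, hx, if_true]
        exact h2 x (Finset.disjoint_left.1 hXZ hx)
      · simp only [hc₀, hx, if_false]
        exact (h1 x hx).symm
    all_goals simp
  · simp

/-- Operators with disjoint supports commute. -/
theorem SupportedOn.commute {X Z : Finset Λ} (hXZ : Disjoint X Z) {A B : Op σ}
    (hA : SupportedOn X A) (hB : SupportedOn Z B) : Commute A B := by
  obtain ⟨M, hM⟩ := hA
  obtain ⟨N, hN⟩ := hB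
  refine Op.ext_single fun a b => ?_
  rw [mul_apply_single_of_disjoint hXZ hM hN, mul_apply_single_of_disjoint hXZ.symm hN hM,
    Finset.union_comm, mul_comm]

end Support

/-- The derivative along the path of a curve in a closed subspace lies in that subspace. -/
lemma pathDeriv_mem {E : Type*} [NormedAddCommGroup E] [NormedSpace ℝ E] (S : Submodule ℝ E)
    (hS : IsClosed (S : Set E)) {f : ℝ → E} (h : ∀ g ∈ Icc (0 : ℝ) 1, f g ∈ S) (g : ℝ) :
    pathDeriv f g ∈ S := by
  have h1 := range_derivWithin_subset_closure_span_image f (s := Icc (0 : ℝ) 1) (t := Icc 0 1)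
    (by rw [inter_self]; exact subset_closure)
  have h2 : Submodule.span ℝ (f '' Icc 0 1) ≤ S :=
    Submodule.span_le.2 (image_subset_iff.2 h)
  exact closure_minimal h2 hS (h1 ⟨g, rfl⟩)

/-! ### The Lieb–Robinson bound -/

section LiebRobinson

variable {Λ : Type*} [MetricSpace Λ]

/-- The weight `∑_{x ∈ X} e^{-μ d(x,B)}` of a region, as seen from the site `B`. -/
noncomputable def regionWeight (μ : ℝ) (B : Λ) (X : Finset Λ) : ℝ :=
  ∑ x ∈ X, Real.exp (-(μ * dist x B))

lemma regionWeight_nonneg (μ : ℝ) (B : Λ) (X : Finset Λ) : 0 ≤ regionWeight μ B X :=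
  Finset.sum_nonneg fun _ _ => (Real.exp_pos _).le

lemma one_le_regionWeight (μ : ℝ) {B : Λ} {X : Finset Λ} (h : B ∈ X) :
    1 ≤ regionWeight μ B X := by
  refine le_trans ?_ (Finset.single_le_sum (f := fun x => Real.exp (-(μ * dist x B)))
    (fun x _ => (Real.exp_pos _).le) h)
  simp

lemma regionWeight_le_card_mul {μ : ℝ} (hμ : 0 ≤ μ) (B : Λ) (X : Finset Λ) :
    regionWeight μ B X ≤ X.card * Real.exp (-(μ * Metric.infDist B (X : Set Λ))) := by
  rw [← nsmul_eq_mul]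
  refine Finset.sum_le_card_nsmul _ _ _ fun x hx => ?_
  have := Metric.infDist_le_dist_of_mem (x := B) (Finset.mem_coe.2 hx)
  rw [dist_comm] at this
  gcongr

lemma regionWeight_le_of_mem {μ : ℝ} (hμ : 0 ≤ μ) (B : Λ) {Z : Finset Λ} {x : Λ} (hx : x ∈ Z) :
    regionWeight μ B Z ≤
      Z.card * Real.exp (μ * Metric.diam (Z : Set Λ)) * Real.exp (-(μ * dist x B)) := by
  rw [mul_assoc, ← Real.exp_add, ← nsmul_eq_mul]
  refine Finset.sum_le_card_nsmul _ _ _ fun z hz => ?_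
  rw [Real.exp_le_exp]
  have h1 := Metric.dist_le_diam_of_mem Z.finite_toSet.isBounded (Finset.mem_coe.2 hx)
    (Finset.mem_coe.2 hz)
  have h2 := dist_triangle x z B
  nlinarith

variable [Fintype Λ] [DecidableEq Λ] {σ : Λ → Type*} [∀ x, Fintype (σ x)]

/-- The interactions meeting a region `X` have total weight at most `J` times that of `X`. -/
lemma sum_norm_mul_regionWeight_le {μ J : ℝ} (hμ : 0 ≤ μ) {H : Finset Λ → Op σ}
    (hJ : ∀ u : Λ, ∑ Z : Finset Λ with u ∈ Z,
      ‖H Z‖ * (Z.card : ℝ) * Real.exp (μ * Metric.diam (Z : Set Λ)) ≤ J)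
    (B : Λ) (X : Finset Λ) :
    ∑ Z : Finset Λ with ¬ Disjoint X Z, ‖H Z‖ * regionWeight μ B Z ≤ J * regionWeight μ B X := by
  have h0 : ∀ Z, 0 ≤ ‖H Z‖ * regionWeight μ B Z := fun Z =>
    mul_nonneg (norm_nonneg _) (regionWeight_nonneg _ _ _)
  calc ∑ Z : Finset Λ with ¬ Disjoint X Z, ‖H Z‖ * regionWeight μ B Z
      ≤ ∑ Z : Finset Λ, ∑ x ∈ X, if x ∈ Z then ‖H Z‖ * regionWeight μ B Z else 0 := by
        rw [Finset.sum_filter]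
        refine Finset.sum_le_sum fun Z _ => ?_
        have hnn : ∀ x ∈ X, 0 ≤ if x ∈ Z then ‖H Z‖ * regionWeight μ B Z else 0 := fun x _ => by
          split_ifs
          exacts [h0 Z, le_rfl]
        split_ifs with hZ
        · exact Finset.sum_nonneg hnn
        · obtain ⟨x, hx, hx'⟩ := Finset.not_disjoint_iff.1 hZ
          refine le_trans ?_ (Finset.single_le_sum hnn hx)
          rw [if_pos hx']
    _ = ∑ x ∈ X, ∑ Z : Finset Λ with x ∈ Z, ‖H Z‖ * regionWeight μ B Z := by
        rw [Finset.sum_comm]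
        exact Finset.sum_congr rfl fun x _ => (Finset.sum_filter _ _).symm
    _ ≤ ∑ x ∈ X, J * Real.exp (-(μ * dist x B)) := by
        refine Finset.sum_le_sum fun x _ => ?_
        refine le_trans ?_ (mul_le_mul_of_nonneg_right (hJ x) (Real.exp_pos _).le)
        rw [Finset.sum_mul]
        refine Finset.sum_le_sum fun Z hZ => ?_
        have := regionWeight_le_of_mem hμ B (Finset.mem_filter.1 hZ).2
        calc _ ≤ ‖H Z‖ * (Z.card * Real.exp (μ * Metric.diam (Z : Set Λ)) *
              Real.exp (-(μ * dist x B))) := by gcongr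
          _ = _ := by ring
    _ = _ := by rw [regionWeight, Finset.mul_sum]

variable [∀ x, DecidableEq (σ x)]

/-- The Lieb–Robinson bound for positive times. If the bound holds with some constant `K` in place
of `4`, the integral inequality improves `K` to `2 + K / 2`; iterating leads to `4`. -/
theorem liebRobinson_of_nonneg {μ J : ℝ} (hμ : 0 ≤ μ) (hJ0 : 0 < J) {H : Finset Λ → Op σ}
    (hsupp : ∀ Z, SupportedOn Z (H Z)) (hsa : ∀ Z, IsSelfAdjoint (H Z))
    (hJ : ∀ u : Λ, ∑ Z : Finset Λ with u ∈ Z,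
      ‖H Z‖ * (Z.card : ℝ) * Real.exp (μ * Metric.diam (Z : Set Λ)) ≤ J)
    {B : Λ} {O : Op σ} (hO : SupportedOn {B} O) {X : Finset Λ} (hX : X.Nonempty) {A : Op σ}
    (hA : SupportedOn X A) {t : ℝ} (ht : 0 ≤ t) :
    ‖heisenberg (∑ Z, H Z) t A * O - O * heisenberg (∑ Z, H Z) t A‖ ≤
      4 * ‖O‖ * ‖A‖ * regionWeight μ B X * Real.exp (4 * J * t) := by
  set Ht : Op σ := ∑ Z, H Z with hHt
  have hHsa : IsSelfAdjoint Ht := isSelfAdjoint_sum (R := Op σ) _ fun Z _ => hsa Z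
  have comm0 : ∀ (X : Finset Λ) (A : Op σ), SupportedOn X A →
      ‖A * O - O * A‖ ≤ 2 * ‖A‖ * ‖O‖ * regionWeight μ B X := by
    intro X A hA
    by_cases hB : B ∈ X
    · exact (norm_commutator_le A O).trans
        (le_mul_of_one_le_right (by positivity) (one_le_regionWeight μ hB))
    · have : Commute A O := hA.commute (by simpa using hB) hO
      rw [this.eq, sub_self, norm_zero]
      have := regionWeight_nonneg μ B X
      positivity
  have improve : ∀ K : ℝ, 0 ≤ K → (∀ (X : Finset Λ) (A : Op σ), X.Nonempty → SupportedOn X A →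
      ∀ t, 0 ≤ t → ‖heisenberg Ht t A * O - O * heisenberg Ht t A‖ ≤
        K * ‖A‖ * regionWeight μ B X * Real.exp (4 * J * t)) →
      ∀ (X : Finset Λ) (A : Op σ), X.Nonempty → SupportedOn X A →
      ∀ t, 0 ≤ t → ‖heisenberg Ht t A * O - O * heisenberg Ht t A‖ ≤
        (2 * ‖O‖ + K / 2) * ‖A‖ * regionWeight μ B X * Real.exp (4 * J * t) := by
    intro K hK ih X A _ hA t ht
    set R : Op σ := ∑ Z : Finset Λ with Disjoint X Z, H Z with hR
    have hS : Ht - R = ∑ Z : Finset Λ with ¬ Disjoint X Z, H Z := by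
      rw [hHt, hR, ← Finset.sum_filter_add_sum_filter_not Finset.univ (fun Z => Disjoint X Z)]
      abel
    have hRsa : IsSelfAdjoint R := isSelfAdjoint_sum (R := Op σ) _ fun Z _ => hsa Z
    have hAR : Commute A R := Commute.sum_right _ _ _ fun Z hZ =>
      hA.commute (Finset.mem_filter.1 hZ).2 (hsupp Z)
    have hw := regionWeight_nonneg μ B X
    have hbder : ∀ s : ℝ, HasDerivAt (fun s => K * regionWeight μ B X / 4 * Real.exp (4 * J * s))
        (K * (J * regionWeight μ B X) * Real.exp (4 * J * s)) s := by
      intro s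
      have h1 : HasDerivAt (fun s : ℝ => 4 * J * s) (4 * J) s := by
        simpa using (hasDerivAt_id s).const_mul (4 * J)
      refine (h1.exp.const_mul (K * regionWeight μ B X / 4)).congr_deriv ?_
      ring
    have hmain := norm_commutator_heisenberg_le (O := O) hHsa hRsa hAR hbder ht (fun s hs => by
      have e : heisenberg Ht s (Ht - R) * O - O * heisenberg Ht s (Ht - R) =
          ∑ Z : Finset Λ with ¬ Disjoint X Z,
            (heisenberg Ht s (H Z) * O - O * heisenberg Ht s (H Z)) := by
        rw [hS, heisenberg, Finset.mul_sum, Finset.sum_mul, Finset.sum_mul, Finset.mul_sum,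
          ← Finset.sum_sub_distrib]
        rfl
      rw [e]
      calc _ ≤ ∑ Z : Finset Λ with ¬ Disjoint X Z,
            K * (‖H Z‖ * regionWeight μ B Z) * Real.exp (4 * J * s) := by
            refine (norm_sum_le _ _).trans (Finset.sum_le_sum fun Z hZ => ?_)
            have hZne : Z.Nonempty := by
              obtain ⟨x, -, hx⟩ := Finset.not_disjoint_iff.1 (Finset.mem_filter.1 hZ).2
              exact ⟨x, hx⟩
            refine (ih Z (H Z) hZne (hsupp Z) s hs).trans_eq ?_
            ring
        _ = K * (∑ Z : Finset Λ with ¬ Disjoint X Z, ‖H Z‖ * regionWeight μ B Z) *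
              Real.exp (4 * J * s) := by rw [Finset.mul_sum, Finset.sum_mul]
        _ ≤ _ := by
            have := sum_norm_mul_regionWeight_le hμ hJ B X
            gcongr)
    have hexp : 1 ≤ Real.exp (4 * J * t) := Real.one_le_exp (by positivity)
    calc _ ≤ _ := hmain
      _ ≤ 2 * ‖A‖ * ‖O‖ * regionWeight μ B X * Real.exp (4 * J * t) +
          2 * ‖A‖ * (K * regionWeight μ B X / 4 * Real.exp (4 * J * t)) := by
          refine add_le_add ((comm0 X A hA).trans
            (le_mul_of_one_le_right (by positivity) hexp)) ?_
          refine mul_le_mul_of_nonneg_left (sub_le_self _ ?_) (by positivity)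
          positivity
      _ = _ := by ring
  -- the crude bound `2‖A‖‖O‖` starts the iteration, since a nonempty region has positive weight
  obtain ⟨c, hc0, hc⟩ : ∃ c : ℝ, 0 < c ∧ ∀ X : Finset Λ, X.Nonempty → c ≤ regionWeight μ B X := by
    refine ⟨Real.exp (-(μ * Metric.diam (univ : Set Λ))), Real.exp_pos _, fun X hX => ?_⟩
    obtain ⟨x, hx⟩ := hX
    refine le_trans ?_ (Finset.single_le_sum (f := fun x => Real.exp (-(μ * dist x B)))
      (fun x _ => (Real.exp_pos _).le) hx)
    have := Metric.dist_le_diam_of_mem (Set.toFinite (univ : Set Λ)).isBounded (mem_univ x)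
      (mem_univ B)
    gcongr
  have iter : ∀ n : ℕ, ∀ (X : Finset Λ) (A : Op σ), X.Nonempty → SupportedOn X A →
      ∀ t, 0 ≤ t → ‖heisenberg Ht t A * O - O * heisenberg Ht t A‖ ≤
        (4 * ‖O‖ + 2 * ‖O‖ / c * (1 / 2) ^ n) * ‖A‖ * regionWeight μ B X *
          Real.exp (4 * J * t) := by
    intro n
    induction n with
    | zero =>
      intro X A hX _ t ht
      have hexp : 1 ≤ Real.exp (4 * J * t) := Real.one_le_exp (by positivity)
      have h1 : 2 * ‖A‖ * ‖O‖ ≤ 2 * ‖O‖ / c * ‖A‖ * regionWeight μ B X := by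
        calc 2 * ‖A‖ * ‖O‖ = 2 * ‖O‖ / c * ‖A‖ * c := by field_simp
          _ ≤ _ := by gcongr; exact hc X hX
      have hw := regionWeight_nonneg μ B X
      calc _ ≤ 2 * ‖heisenberg Ht t A‖ * ‖O‖ := norm_commutator_le _ _
        _ = 2 * ‖A‖ * ‖O‖ := by rw [norm_heisenberg hHsa]
        _ ≤ 2 * ‖O‖ / c * ‖A‖ * regionWeight μ B X * Real.exp (4 * J * t) :=
            h1.trans (le_mul_of_one_le_right (by positivity) hexp)
        _ ≤ _ := by
            gcongr
            rw [pow_zero, mul_one]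
            exact le_add_of_nonneg_left (by positivity)
    | succ n ih =>
      intro X A hX hA t ht
      refine (improve _ (by positivity) ih X A hX hA t ht).trans_eq ?_
      ring
  have hlim : Filter.Tendsto (fun n : ℕ => (4 * ‖O‖ + 2 * ‖O‖ / c * (1 / 2) ^ n) * ‖A‖ *
      regionWeight μ B X * Real.exp (4 * J * t)) Filter.atTop
      (nhds ((4 * ‖O‖ + 2 * ‖O‖ / c * 0) * ‖A‖ * regionWeight μ B X * Real.exp (4 * J * t))) := by
    have h1 : Filter.Tendsto (fun n : ℕ => (1 / 2 : ℝ) ^ n) Filter.atTop (nhds 0) :=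
      tendsto_pow_atTop_nhds_zero_of_lt_one (by norm_num) (by norm_num)
    exact ((((h1.const_mul _).const_add _).mul_const _).mul_const _).mul_const _
  rw [mul_zero, add_zero] at hlim
  exact ge_of_tendsto' hlim fun n => iter n X A hX hA t ht

/-- The Lieb–Robinson bound. -/
theorem liebRobinson {μ J : ℝ} (hμ : 0 ≤ μ) (hJ0 : 0 < J) {H : Finset Λ → Op σ}
    (hsupp : ∀ Z, SupportedOn Z (H Z)) (hsa : ∀ Z, IsSelfAdjoint (H Z))
    (hJ : ∀ u : Λ, ∑ Z : Finset Λ with u ∈ Z,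
      ‖H Z‖ * (Z.card : ℝ) * Real.exp (μ * Metric.diam (Z : Set Λ)) ≤ J)
    {B : Λ} {O : Op σ} (hO : SupportedOn {B} O) {X : Finset Λ} (hX : X.Nonempty) {A : Op σ}
    (hA : SupportedOn X A) (t : ℝ) :
    ‖heisenberg (∑ Z, H Z) t A * O - O * heisenberg (∑ Z, H Z) t A‖ ≤
      4 * ‖O‖ * ‖A‖ * (X.card * Real.exp (-(μ * Metric.infDist B (X : Set Λ)))) *
        Real.exp (4 * J * |t|) := by
  have hw := regionWeight_le_card_mul hμ B X
  rcases le_total 0 t with ht | ht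
  · rw [abs_of_nonneg ht]
    refine (liebRobinson_of_nonneg hμ hJ0 hsupp hsa hJ hO hX hA ht).trans ?_
    gcongr
  · rw [abs_of_nonpos ht]
    -- evolution backwards in time is evolution under `-H`
    have h := liebRobinson_of_nonneg hμ hJ0 (H := fun Z => -H Z)
      (fun Z => (supportedSubmodule σ Z).neg_mem (hsupp Z))
      (fun Z => IsSelfAdjoint.neg (R := Op σ) (hsa Z))
      (by simpa only [norm_neg] using hJ) hO hX hA (neg_nonneg.2 ht)
    rw [Finset.sum_neg_distrib, heisenberg_neg, neg_neg] at h
    refine h.trans ?_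
    gcongr

end LiebRobinson

/-! ### The filtered generator -/

section Filtered

variable {E : Type*} [NormedAddCommGroup E] [InnerProductSpace ℂ E] [CompleteSpace E]
  {F : ℝ → ℂ} {H D : E →L[ℂ] E}

lemma filteredOp_eq (F : ℝ → ℂ) (H D : E →L[ℂ] E) :
    filteredOp F H D = Complex.I • ∫ t : ℝ, F t • heisenberg H t D := by
  simp only [filteredOp, heisenberg, phaseExp, Complex.ofReal_neg, mul_neg]

lemma integrable_smul_heisenberg (hF : Integrable F) (hH : IsSelfAdjoint H) (D : E →L[ℂ] E) :
    Integrable fun t : ℝ => F t • heisenberg H t D := by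
  refine (hF.norm.mul_const ‖D‖).mono'
    (hF.1.smul (continuous_heisenberg H D).aestronglyMeasurable) ?_
  refine Filter.Eventually.of_forall fun t => ?_
  rw [norm_smul, norm_heisenberg hH]

lemma norm_filteredOp_le (hF : Integrable F) (hH : IsSelfAdjoint H) (D : E →L[ℂ] E) :
    ‖filteredOp F H D‖ ≤ (∫ t, ‖F t‖) * ‖D‖ := by
  rw [filteredOp_eq, norm_smul, Complex.norm_I, one_mul, ← integral_mul_const]
  refine norm_integral_le_of_norm_le (hF.norm.mul_const ‖D‖) ?_
  refine Filter.Eventually.of_forall fun t => ?_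
  rw [norm_smul, norm_heisenberg hH]

lemma filteredOp_sum (hF : Integrable F) (hH : IsSelfAdjoint H) {ι : Type*} (s : Finset ι)
    (D : ι → E →L[ℂ] E) : filteredOp F H (∑ i ∈ s, D i) = ∑ i ∈ s, filteredOp F H (D i) := by
  simp only [filteredOp_eq]
  rw [← Finset.smul_sum, ← integral_finsetSum _ fun i _ => integrable_smul_heisenberg hF hH (D i)]
  simp only [heisenberg, Finset.mul_sum, Finset.sum_mul, Finset.smul_sum]

lemma isSelfAdjoint_filteredOp (hH : IsSelfAdjoint H) (hD : IsSelfAdjoint D)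
    (hre : ∀ t, (F t).re = 0) : IsSelfAdjoint (filteredOp F H D) := by
  have h1 : star (∫ t : ℝ, F t • heisenberg H t D) = -∫ t : ℝ, F t • heisenberg H t D := by
    have := (starL' ℝ : (E →L[ℂ] E) ≃L[ℝ] (E →L[ℂ] E)).integral_comp_comm
      (fun t : ℝ => F t • heisenberg H t D) (μ := volume)
    simp only [starL'_apply] at this
    rw [← this, ← integral_neg]
    refine integral_congr_ae (Filter.Eventually.of_forall fun t => ?_)
    have e : star (F t) = -F t := by
      apply Complex.ext <;> simp [hre t]
    simp only [star_smul, star_heisenberg hH, hD.star_eq, e, neg_smul]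
  rw [IsSelfAdjoint, filteredOp_eq, star_smul, h1]
  simp

lemma commutator_filteredOp_le (hF : Integrable F) (hH : IsSelfAdjoint H) (D O : E →L[ℂ] E)
    {b : ℝ → ℝ} (hb : Integrable b)
    (h : ∀ t, ‖F t‖ * ‖heisenberg H t D * O - O * heisenberg H t D‖ ≤ b t) :
    ‖filteredOp F H D * O - O * filteredOp F H D‖ ≤ ∫ t, b t := by
  set L : (E →L[ℂ] E) →L[ℂ] (E →L[ℂ] E) :=
    (ContinuousLinearMap.mul ℂ (E →L[ℂ] E)).flip O - ContinuousLinearMap.mul ℂ (E →L[ℂ] E) O with hL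
  have hLa : ∀ A, L A = A * O - O * A := fun A => by simp [hL]
  rw [← hLa, filteredOp_eq, map_smul, norm_smul, Complex.norm_I, one_mul,
    ← L.integral_comp_comm (integrable_smul_heisenberg hF hH D)]
  refine norm_integral_le_of_norm_le hb (Filter.Eventually.of_forall fun t => ?_)
  rw [map_smul, norm_smul, hLa]
  exact h t

/-- Along a continuous path of Hamiltonians, the filtered generator inherits integrability from the
filtered operator. -/
lemma intervalIntegrable_filteredOp (hF : Integrable F) {H D : ℝ → E →L[ℂ] E}
    (hH : ContinuousOn H (Icc 0 1)) (hsa : ∀ g ∈ Icc (0 : ℝ) 1, IsSelfAdjoint (H g))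
    (hD : IntervalIntegrable D volume 0 1) :
    IntervalIntegrable (fun g => filteredOp F (H g) (D g)) volume 0 1 := by
  let +nondep : NormedAlgebra ℚ (E →L[ℂ] E) := .restrictScalars ℚ ℂ (E →L[ℂ] E)
  rw [intervalIntegrable_iff_integrableOn_Ioc_of_le zero_le_one] at hD ⊢
  have hHm : AEStronglyMeasurable H (volume.restrict (Ioc (0 : ℝ) 1)) :=
    (hH.mono Ioc_subset_Icc_self).aestronglyMeasurable measurableSet_Ioc
  have hjoint : AEStronglyMeasurable (fun q : ℝ × ℝ => F q.2 •
      (NormedSpace.exp ((Complex.I * (q.2 : ℂ)) • H q.1) * D q.1 *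
        NormedSpace.exp ((-(Complex.I * (q.2 : ℂ))) • H q.1)))
      ((volume.restrict (Ioc (0 : ℝ) 1)).prod volume) := by
    have h1 : AEStronglyMeasurable (fun q : ℝ × ℝ => H q.1)
      ((volume.restrict (Ioc (0 : ℝ) 1)).prod (volume : Measure ℝ)) := hHm.comp_fst
    have h2 : AEStronglyMeasurable (fun q : ℝ × ℝ => D q.1)
      ((volume.restrict (Ioc (0 : ℝ) 1)).prod (volume : Measure ℝ)) := hD.1.comp_fst
    have h3 : AEStronglyMeasurable (fun q : ℝ × ℝ => F q.2)
      ((volume.restrict (Ioc (0 : ℝ) 1)).prod (volume : Measure ℝ)) := hF.1.comp_snd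
    have h4 : Continuous fun q : ℝ × ℝ => Complex.I * (q.2 : ℂ) := by fun_prop
    refine h3.smul ((AEStronglyMeasurable.mul ?_ h2).mul ?_)
    · exact NormedSpace.exp_continuous.comp_aestronglyMeasurable
        (h4.aestronglyMeasurable.smul h1)
    · exact NormedSpace.exp_continuous.comp_aestronglyMeasurable
        (h4.neg.aestronglyMeasurable.smul h1)
  refine (hD.norm.const_mul (∫ t, ‖F t‖)).mono'
    (hjoint.integral_prod_right'.const_smul Complex.I) ?_
  filter_upwards [ae_restrict_mem measurableSet_Ioc] with g hg
  exact norm_filteredOp_le hF (hsa g (Ioc_subset_Icc_self hg)) (D g)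

end Filtered

/-! ### Quasi-locality -/

section QuasiLocal

/-- The decay profile of the generator: the Lieb–Robinson bound controls times up to
`μ l / (8 J)`, and the filter function is small beyond. -/
noncomputable def decayProfile (F : ℝ → ℂ) (μ J l : ℝ) : ℝ :=
  4 * (∫ t, ‖F t‖) * Real.exp (-(μ / 2 * l)) + 2 * ∫ t in {t : ℝ | μ / (8 * J) * l < |t|}, ‖F t‖

lemma superpolynomialDecay_exp_neg {a : ℝ} (ha : 0 < a) :
    Asymptotics.SuperpolynomialDecay Filter.atTop (fun l : ℝ => l)
      fun l => Real.exp (-(a * l)) := by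
  intro n
  have h := (Real.tendsto_pow_mul_exp_neg_atTop_nhds_zero n).comp
    (Filter.tendsto_id.const_mul_atTop ha)
  have h2 := h.const_mul ((a ^ n)⁻¹)
  rw [mul_zero] at h2
  refine h2.congr fun l => ?_
  simp only [Function.comp, id, mul_pow]
  field_simp

lemma superpolynomialDecay_tail {F : ℝ → ℂ} (hF : Integrable F)
    (hmom : ∀ n : ℕ, Integrable fun t => |t| ^ n * ‖F t‖) {c : ℝ} (hc : 0 < c) :
    Asymptotics.SuperpolynomialDecay Filter.atTop (fun l : ℝ => l)
      fun l => ∫ t in {t : ℝ | c * l < |t|}, ‖F t‖ := by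
  refine (Asymptotics.superpolynomialDecay_iff_abs_isBoundedUnder _ Filter.tendsto_id).2 fun n => ?_
  refine ⟨(c ^ n)⁻¹ * ∫ t, |t| ^ n * ‖F t‖, ?_⟩
  simp only [Filter.eventually_map, id]
  filter_upwards [Filter.eventually_ge_atTop 0] with l hl
  have h0 : 0 ≤ ∫ t in {t : ℝ | c * l < |t|}, ‖F t‖ := integral_nonneg fun _ => norm_nonneg _
  rw [abs_of_nonneg (by positivity), le_inv_mul_iff₀ (by positivity), ← mul_assoc, ← mul_pow,
    ← integral_const_mul]
  have hS : MeasurableSet {t : ℝ | c * l < |t|} :=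
    measurableSet_lt measurable_const continuous_abs.measurable
  refine (setIntegral_mono_on (hF.norm.const_mul _).integrableOn (hmom n).integrableOn hS
    fun t ht => ?_).trans (setIntegral_le_integral (hmom n)
      (Filter.Eventually.of_forall fun t => by positivity))
  have : c * l < |t| := ht
  gcongr

lemma superpolynomialDecay_decayProfile {F : ℝ → ℂ} (hF : Integrable F)
    (hmom : ∀ n : ℕ, Integrable fun t => |t| ^ n * ‖F t‖) {μ J : ℝ} (hμ : 0 < μ) (hJ : 0 < J) :
    Asymptotics.SuperpolynomialDecay Filter.atTop (fun l : ℝ => l) (decayProfile F μ J) :=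
  ((superpolynomialDecay_exp_neg (half_pos hμ)).const_mul _).add
    ((superpolynomialDecay_tail hF hmom (c := μ / (8 * J)) (by positivity)).const_mul 2)

variable {Λ : Type*} [MetricSpace Λ] [Fintype Λ] [DecidableEq Λ] {σ : Λ → Type*}
  [∀ x, Fintype (σ x)] [∀ x, DecidableEq (σ x)]

/-- Quasi-locality of the filtered generator. The time integral is split at `μ l / (8 J)`: before
that time the Lieb–Robinson bound leaves the factor `e^{-μ l / 2}`, and afterwards the trivial bound
on the commutator suffices. -/
theorem commutator_filteredOp_le_decayProfile {F : ℝ → ℂ} (hF : Integrable F) {μ J : ℝ}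
    (hμ : 0 < μ) (hJ0 : 0 < J) {H : Finset Λ → Op σ}
    (hsupp : ∀ Z, SupportedOn Z (H Z)) (hsa : ∀ Z, IsSelfAdjoint (H Z))
    (hJ : ∀ u : Λ, ∑ Z : Finset Λ with u ∈ Z,
      ‖H Z‖ * (Z.card : ℝ) * Real.exp (μ * Metric.diam (Z : Set Λ)) ≤ J)
    {B : Λ} {O : Op σ} (hO : SupportedOn {B} O) {Z : Finset Λ} {D : Op σ}
    (hD : SupportedOn Z D) :
    ‖filteredOp F (∑ Z, H Z) D * O - O * filteredOp F (∑ Z, H Z) D‖ ≤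
      decayProfile F μ J (Metric.infDist B (Z : Set Λ)) * (Z.card : ℝ) * ‖D‖ * ‖O‖ := by
  have hHsa : IsSelfAdjoint (∑ Z, H Z) := isSelfAdjoint_sum (R := Op σ) _ fun Z _ => hsa Z
  rcases Z.eq_empty_or_nonempty with rfl | hZ
  · -- an operator supported on the empty region is central
    have hcomm : ∀ (W : Finset Λ) (A : Op σ), SupportedOn W A → Commute D A := fun W A hA =>
      hD.commute (Finset.disjoint_empty_left W) hA
    have hDH : Commute D (∑ Z, H Z) := Commute.sum_right _ _ _ fun W _ => hcomm W _ (hsupp W)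
    refine (commutator_filteredOp_le hF hHsa D O (integrable_zero ℝ ℝ volume)
      fun t => ?_).trans ?_
    · have e : heisenberg (∑ Z, H Z) t D = D := by
        rw [heisenberg, ← (hDH.phaseExp_right t).eq, mul_assoc, phaseExp_mul_neg, mul_one]
      rw [e, (hcomm _ O hO).eq, sub_self, norm_zero, mul_zero, Pi.zero_apply]
    · simp
  set l := Metric.infDist B (Z : Set Λ) with hl
  set S : Set ℝ := {t : ℝ | μ / (8 * J) * l < |t|} with hS
  have hSm : MeasurableSet S := measurableSet_lt measurable_const continuous_abs.measurable
  have hcard : (1 : ℝ) ≤ Z.card := by exact_mod_cast hZ.card_pos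
  have hint : Integrable fun t => (Z.card : ℝ) * ‖D‖ * ‖O‖ *
      (4 * Real.exp (-(μ / 2 * l)) * ‖F t‖ + 2 * S.indicator (fun t => ‖F t‖) t) :=
    (((hF.norm.const_mul _).add ((hF.norm.indicator hSm).const_mul 2)).const_mul _)
  refine (commutator_filteredOp_le hF hHsa D O hint fun t => ?_).trans_eq ?_
  · by_cases ht : t ∈ S
    · rw [indicator_of_mem ht]
      have h1 := norm_commutator_le (heisenberg (∑ Z, H Z) t D) O
      rw [norm_heisenberg hHsa] at h1
      calc _ ≤ ‖F t‖ * (2 * ‖D‖ * ‖O‖) := by gcongr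
        _ = 1 * (‖D‖ * ‖O‖ * (2 * ‖F t‖)) := by ring
        _ ≤ Z.card * (‖D‖ * ‖O‖ * (4 * Real.exp (-(μ / 2 * l)) * ‖F t‖ + 2 * ‖F t‖)) := by
            gcongr
            exact le_add_of_nonneg_left (by positivity)
        _ = _ := by ring
    · rw [indicator_of_notMem ht, mul_zero, add_zero]
      have ht' : |t| ≤ μ / (8 * J) * l := not_lt.1 ht
      have hexp : Real.exp (-(μ * l)) * Real.exp (4 * J * |t|) ≤ Real.exp (-(μ / 2 * l)) := by
        rw [← Real.exp_add, Real.exp_le_exp]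
        have : 4 * J * |t| ≤ 4 * J * (μ / (8 * J) * l) := by gcongr
        have e : 4 * J * (μ / (8 * J) * l) = μ / 2 * l := by field_simp; ring
        linarith
      calc _ ≤ ‖F t‖ * (4 * ‖O‖ * ‖D‖ * (Z.card * Real.exp (-(μ * l))) *
            Real.exp (4 * J * |t|)) := by
            gcongr
            exact liebRobinson hμ.le hJ0 hsupp hsa hJ hO hZ hD t
        _ = ‖F t‖ * (4 * ‖O‖ * ‖D‖ * Z.card) *
            (Real.exp (-(μ * l)) * Real.exp (4 * J * |t|)) := by ring
        _ ≤ ‖F t‖ * (4 * ‖O‖ * ‖D‖ * Z.card) * Real.exp (-(μ / 2 * l)) := by gcongr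
        _ = _ := by ring
  · rw [integral_const_mul, integral_add (hF.norm.const_mul _)
      ((hF.norm.indicator hSm).const_mul 2), integral_const_mul, integral_const_mul,
      integral_indicator hSm, decayProfile]
    ring

end QuasiLocal

/-! ### Gapped ground states -/

section Gap

variable {E : Type*} [NormedAddCommGroup E] [InnerProductSpace ℂ E]

/-- The energy `⟨Φ, H Φ⟩` of a unit vector `Φ`; if `Φ` is a ground state of `H`, it is the ground
state energy. -/
noncomputable def groundEnergy (H : E →L[ℂ] E) (Φ : E) : ℝ := (inner ℂ Φ (H Φ)).re

variable {Δ : ℝ} {H : E →L[ℂ] E} {Φ : E}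

lemma IsGappedGroundState.inner_self (h : IsGappedGroundState Δ H Φ) :
    inner ℂ Φ Φ = (1 : ℂ) := by
  rw [inner_self_eq_norm_sq_to_K, h.1]; simp

lemma IsGappedGroundState.apply_eq (h : IsGappedGroundState Δ H Φ) :
    H Φ = (groundEnergy H Φ : ℂ) • Φ := by
  obtain ⟨E₀, hE, -⟩ := h.2
  have : groundEnergy H Φ = E₀ := by
    rw [groundEnergy, hE, inner_smul_right, h.inner_self, mul_one, Complex.ofReal_re]
  rw [this, hE]

lemma IsGappedGroundState.le_of_apply_eq (h : IsGappedGroundState Δ H Φ) {e : ℝ} {ψ : E}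
    (h0 : ψ ≠ 0) (hψ : inner ℂ Φ ψ = (0 : ℂ)) (he : H ψ = (e : ℂ) • ψ) :
    groundEnergy H Φ + Δ ≤ e := by
  obtain ⟨E₀, hE, hgap⟩ := h.2
  have : groundEnergy H Φ = E₀ := by
    rw [groundEnergy, hE, inner_smul_right, h.inner_self, mul_one, Complex.ofReal_re]
  rw [this]
  exact hgap e ψ h0 hψ he

lemma inner_self_eq_ofReal_norm_sq (w : E) : inner ℂ w w = ((‖w‖ ^ 2 : ℝ) : ℂ) := by
  rw [inner_self_eq_norm_sq_to_K]
  norm_cast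

lemma IsGappedGroundState.exists_orthogonal_decomposition (h : IsGappedGroundState Δ H Φ) (u : E) :
    ∃ w, inner ℂ Φ w = (0 : ℂ) ∧ u = (inner ℂ Φ u : ℂ) • Φ + w :=
  ⟨u - (inner ℂ Φ u : ℂ) • Φ, by
    rw [inner_sub_right, inner_smul_right, h.inner_self, mul_one, sub_self], by abel⟩

lemma norm_sq_add_of_orthogonal (hΦ : ‖Φ‖ = 1) (c : ℂ) {w : E} (hw : inner ℂ Φ w = (0 : ℂ)) :
    ‖c • Φ + w‖ ^ 2 = ‖c‖ ^ 2 + ‖w‖ ^ 2 := by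
  have := norm_add_sq_eq_norm_sq_add_norm_sq_of_inner_eq_zero (𝕜 := ℂ) (c • Φ) w
    (by rw [inner_smul_left, hw, mul_zero])
  rw [norm_smul, hΦ, mul_one] at this
  simpa only [sq] using this

variable [CompleteSpace E]

lemma IsSelfAdjoint.inner_map_comm (hH : IsSelfAdjoint H) (x y : E) :
    inner ℂ (H x) y = inner ℂ x (H y) :=
  hH.isSymmetric x y

lemma IsGappedGroundState.inner_map_eq_zero (h : IsGappedGroundState Δ H Φ)
    (hH : IsSelfAdjoint H) {w : E} (hw : inner ℂ Φ w = (0 : ℂ)) : inner ℂ Φ (H w) = (0 : ℂ) := by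
  rw [← hH.inner_map_comm, h.apply_eq, inner_smul_left, hw, mul_zero]

/-- The orthogonal complement of a gapped ground state has an orthonormal basis of eigenvectors
lying above the gap. -/
lemma IsGappedGroundState.exists_eigenbasis [FiniteDimensional ℂ E]
    (h : IsGappedGroundState Δ H Φ) (hH : IsSelfAdjoint H) :
    ∃ (n : ℕ) (v : Fin n → E) (ℓ : Fin n → ℝ), (∀ i, inner ℂ Φ (v i) = (0 : ℂ)) ∧
      (∀ i, H (v i) = (ℓ i : ℂ) • v i) ∧ (∀ i, groundEnergy H Φ + Δ ≤ ℓ i) ∧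
      ∀ u, inner ℂ Φ u = (0 : ℂ) → u = ∑ i, (inner ℂ (v i) u : ℂ) • v i := by
  set S : Submodule ℂ E := (Submodule.span ℂ {Φ})ᗮ with hS
  have hmem : ∀ u, u ∈ S ↔ inner ℂ Φ u = (0 : ℂ) := fun u =>
    Submodule.mem_orthogonal_singleton_iff_inner_right
  have hinv : ∀ u ∈ S, (H : E →ₗ[ℂ] E) u ∈ S := fun u hu =>
    (hmem _).2 (h.inner_map_eq_zero hH ((hmem u).1 hu))
  have hT := hH.isSymmetric.restrict_invariant hinv
  let b := hT.eigenvectorBasis rfl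
  have hb : ∀ i, H (b i) = (hT.eigenvalues rfl i : ℂ) • (b i : E) := fun i => by
    exact congrArg Subtype.val (hT.apply_eigenvectorBasis rfl i)
  have hb0 : ∀ i, inner ℂ Φ (b i : E) = (0 : ℂ) := fun i => (hmem _).1 (b i).2
  refine ⟨_, fun i => (b i : E), hT.eigenvalues rfl, hb0, hb,
    fun i => h.le_of_apply_eq ?_ (hb0 i) (hb i), fun u hu => ?_⟩
  · have := b.orthonormal.ne_zero i
    simpa using this
  · have := congrArg Subtype.val (b.sum_repr' ⟨u, (hmem u).2 hu⟩)
    simpa using this.symm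

/-- The energy of a state orthogonal to the ground state lies above the gap. -/
lemma IsGappedGroundState.le_inner_map [FiniteDimensional ℂ E] (h : IsGappedGroundState Δ H Φ)
    (hH : IsSelfAdjoint H) {w : E} (hw : inner ℂ Φ w = (0 : ℂ)) :
    (groundEnergy H Φ + Δ) * ‖w‖ ^ 2 ≤ (inner ℂ w (H w)).re := by
  obtain ⟨n, v, ℓ, -, hv, hℓ, hsum⟩ := h.exists_eigenbasis hH
  have hc : ∀ i, (inner ℂ (v i) w : ℂ) * inner ℂ w (v i) =
      ((‖(inner ℂ (v i) w : ℂ)‖ ^ 2 : ℝ) : ℂ) :=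
    fun i => by
      rw [← inner_conj_symm w (v i), Complex.mul_conj, Complex.normSq_eq_norm_sq]
  have h1 : ‖w‖ ^ 2 = ∑ i, ‖(inner ℂ (v i) w : ℂ)‖ ^ 2 := by
    have e : (inner ℂ w w : ℂ) = ((∑ i, ‖(inner ℂ (v i) w : ℂ)‖ ^ 2 : ℝ) : ℂ) := by
      nth_rw 2 [hsum w hw]
      rw [inner_sum, Complex.ofReal_sum]
      exact Finset.sum_congr rfl fun i _ => by rw [inner_smul_right, hc]
    rw [inner_self_eq_ofReal_norm_sq] at e
    exact Complex.ofReal_injective e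
  have h2 : (inner ℂ w (H w)).re = ∑ i, ℓ i * ‖(inner ℂ (v i) w : ℂ)‖ ^ 2 := by
    have e : (inner ℂ w (H w) : ℂ) = ((∑ i, ℓ i * ‖(inner ℂ (v i) w : ℂ)‖ ^ 2 : ℝ) : ℂ) := by
      nth_rw 2 [hsum w hw]
      rw [map_sum, inner_sum, Complex.ofReal_sum]
      refine Finset.sum_congr rfl fun i _ => ?_
      rw [map_smul, hv, inner_smul_right, inner_smul_right, Complex.ofReal_mul, ← hc]
      ring
    rw [e, Complex.ofReal_re]
  rw [h1, h2, Finset.mul_sum]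
  exact Finset.sum_le_sum fun i _ => mul_le_mul_of_nonneg_right (hℓ i) (sq_nonneg _)

/-- On the orthogonal complement of the ground state, `H - E₀` is bounded below by the gap. -/
lemma IsGappedGroundState.norm_le [FiniteDimensional ℂ E] (h : IsGappedGroundState Δ H Φ)
    (hH : IsSelfAdjoint H) {w : E} (hw : inner ℂ Φ w = (0 : ℂ)) :
    Δ * ‖w‖ ≤ ‖H w - (groundEnergy H Φ : ℂ) • w‖ := by
  rcases eq_or_ne w 0 with rfl | hw0
  · simp
  have h1 := h.le_inner_map hH hw
  have h2 : (inner ℂ w (H w - (groundEnergy H Φ : ℂ) • w)).re =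
      (inner ℂ w (H w)).re - groundEnergy H Φ * ‖w‖ ^ 2 := by
    rw [inner_sub_right, inner_smul_right, inner_self_eq_ofReal_norm_sq, Complex.sub_re,
      ← Complex.ofReal_mul, Complex.ofReal_re]
  have h3 : (inner ℂ w (H w - (groundEnergy H Φ : ℂ) • w)).re ≤
      ‖w‖ * ‖H w - (groundEnergy H Φ : ℂ) • w‖ :=
    (Complex.re_le_norm _).trans (norm_inner_le_norm _ _)
  have h4 : 0 < ‖w‖ := norm_pos_iff.2 hw0
  refine le_of_mul_le_mul_left ?_ h4
  nlinarith

/-- The variational principle, with a surplus from the excited part of the state. -/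
lemma IsGappedGroundState.variational [FiniteDimensional ℂ E] (h : IsGappedGroundState Δ H Φ)
    (hH : IsSelfAdjoint H) (c : ℂ) {w : E} (hw : inner ℂ Φ w = (0 : ℂ)) :
    groundEnergy H Φ * ‖c • Φ + w‖ ^ 2 + Δ * ‖w‖ ^ 2 ≤
      (inner ℂ (c • Φ + w) (H (c • Φ + w))).re := by
  have h1 := h.le_inner_map hH hw
  have hw' : inner ℂ w Φ = (0 : ℂ) := by rw [← inner_conj_symm, hw, map_zero]
  have h2 : (inner ℂ (c • Φ + w) (H (c • Φ + w)) : ℂ) =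
      ((groundEnergy H Φ * ‖c‖ ^ 2 : ℝ) : ℂ) + inner ℂ w (H w) := by
    rw [map_add, map_smul, h.apply_eq, inner_add_left, inner_add_right, inner_add_right,
      inner_smul_left, inner_smul_left, inner_smul_right, inner_smul_right, inner_smul_right,
      inner_smul_right, h.inner_self, hw', h.inner_map_eq_zero hH hw]
    have : (starRingEnd ℂ) c * c = ((‖c‖ ^ 2 : ℝ) : ℂ) := by
      rw [mul_comm, Complex.mul_conj, Complex.normSq_eq_norm_sq]
    push_cast at this ⊢
    linear_combination (groundEnergy H Φ : ℂ) * this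
  rw [h2, norm_sq_add_of_orthogonal h.1 c hw, Complex.add_re, Complex.ofReal_re]
  nlinarith

/-- First-order perturbation theory for the ground state energy, with a quadratic error bound. -/
lemma abs_groundEnergy_sub_le [FiniteDimensional ℂ E] (hΔ : 0 < Δ)
    (h : IsGappedGroundState Δ H Φ) (hH : IsSelfAdjoint H) {H' : E →L[ℂ] E} {Φ' : E}
    (h' : IsGappedGroundState Δ H' Φ') (hH' : IsSelfAdjoint H') :
    |groundEnergy H' Φ' - groundEnergy H Φ - (inner ℂ Φ ((H' - H) Φ)).re| ≤
      4 / Δ * ‖H' - H‖ ^ 2 := by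
  set X := H' - H with hX
  set q := (inner ℂ Φ (X Φ)).re with hq
  have hH'eq : ∀ ψ : E, (inner ℂ ψ (H' ψ)).re = (inner ℂ ψ (H ψ)).re + (inner ℂ ψ (X ψ)).re := by
    intro ψ
    rw [hX, sub_apply, inner_sub_right, Complex.sub_re]
    ring
  have hre : ∀ x y : E, |(inner ℂ x (X y)).re| ≤ ‖X‖ * ‖x‖ * ‖y‖ := fun x y => by
    calc _ ≤ ‖(inner ℂ x (X y) : ℂ)‖ := Complex.abs_re_le_norm _
      _ ≤ ‖x‖ * ‖X y‖ := norm_inner_le_norm _ _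
      _ ≤ ‖x‖ * (‖X‖ * ‖y‖) := by gcongr; exact X.le_opNorm y
      _ = _ := by ring
  rw [abs_le]
  constructor
  · -- the new ground state as a trial state for the old Hamiltonian
    obtain ⟨w, hw, hdec⟩ := h.exists_orthogonal_decomposition Φ'
    set c : ℂ := inner ℂ Φ Φ' with hc
    have h1 := h.variational hH c hw
    rw [← hdec, h'.1] at h1
    have hn := norm_sq_add_of_orthogonal h.1 c hw
    rw [← hdec, h'.1] at hn
    have hw1 : ‖w‖ ≤ 1 := by nlinarith [sq_nonneg ‖c‖, norm_nonneg w]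
    have hc1 : ‖c‖ ≤ 1 := by nlinarith [sq_nonneg ‖w‖, norm_nonneg c]
    have h2 : (inner ℂ Φ' (X Φ')).re =
        ‖c‖ ^ 2 * q + (inner ℂ (c • Φ) (X w)).re + (inner ℂ w (X Φ')).re := by
      have e1 : (inner ℂ (c • Φ) (X (c • Φ)) : ℂ) = ((‖c‖ ^ 2 : ℝ) : ℂ) * inner ℂ Φ (X Φ) := by
        rw [map_smul, inner_smul_left, inner_smul_right, ← mul_assoc, mul_comm _ c,
          Complex.mul_conj, Complex.normSq_eq_norm_sq]
      have e2 : (inner ℂ Φ' (X Φ') : ℂ) = inner ℂ (c • Φ) (X (c • Φ)) + inner ℂ (c • Φ) (X w) +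
          inner ℂ w (X Φ') := by
        nth_rw 1 [hdec]
        rw [inner_add_left, ← inner_add_right, ← map_add, ← hdec]
      rw [e2, e1, Complex.add_re, Complex.add_re, Complex.re_ofReal_mul]
    have b1 := (abs_le.1 (hre (c • Φ) w)).1
    have b2 := (abs_le.1 (hre w Φ')).1
    have b3 := (abs_le.1 (hre Φ Φ)).2
    rw [norm_smul, h.1, mul_one] at b1
    rw [h'.1] at b2
    rw [h.1] at b3
    have h3 : groundEnergy H' Φ' = (inner ℂ Φ' (H Φ')).re + (inner ℂ Φ' (X Φ')).re := hH'eq Φ'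
    have hX0 := norm_nonneg X
    have hw0 := norm_nonneg w
    have k1 : ‖X‖ * ‖c‖ * ‖w‖ ≤ ‖X‖ * ‖w‖ := by
      rw [mul_assoc]
      exact mul_le_mul_of_nonneg_left (mul_le_of_le_one_left hw0 hc1) hX0
    have k2 : ‖w‖ ^ 2 * q ≤ ‖X‖ * ‖w‖ := by
      have : ‖w‖ ^ 2 ≤ ‖w‖ := by nlinarith
      nlinarith [mul_le_mul_of_nonneg_left b3 (sq_nonneg ‖w‖)]
    have k3 : ‖c‖ ^ 2 * q = q - ‖w‖ ^ 2 * q := by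
      have : ‖c‖ ^ 2 = 1 - ‖w‖ ^ 2 := by linarith
      rw [this]; ring
    -- complete the square
    have k4 : -(4 / Δ * ‖X‖ ^ 2) ≤ Δ * ‖w‖ ^ 2 - 3 * (‖X‖ * ‖w‖) := by
      have e : Δ * ‖w‖ ^ 2 - 3 * (‖X‖ * ‖w‖) + 4 / Δ * ‖X‖ ^ 2 =
          ((Δ * ‖w‖ - 3 / 2 * ‖X‖) ^ 2 + 7 / 4 * ‖X‖ ^ 2) / Δ := by
        field_simp
        ring
      have : 0 ≤ ((Δ * ‖w‖ - 3 / 2 * ‖X‖) ^ 2 + 7 / 4 * ‖X‖ ^ 2) / Δ := by positivity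
      linarith
    linarith
  · -- the old ground state as a trial state for the new Hamiltonian
    obtain ⟨w, hw, hdec⟩ := h'.exists_orthogonal_decomposition Φ
    have h1 := h'.variational hH' (inner ℂ Φ' Φ) hw
    rw [← hdec, h.1, hH'eq] at h1
    have h2 : groundEnergy H Φ = (inner ℂ Φ (H Φ)).re := rfl
    have : 0 ≤ Δ * ‖w‖ ^ 2 := by positivity
    have : 0 ≤ 4 / Δ * ‖X‖ ^ 2 := by positivity
    linarith

/-- The Hellmann–Feynman formula; the choice of phase of the ground states plays no role. -/
theorem hasDerivWithinAt_groundEnergy [FiniteDimensional ℂ E] (hΔ : 0 < Δ)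
    {H D : ℝ → E →L[ℂ] E} {Φ : ℝ → E} {s : Set ℝ} (hsa : ∀ g ∈ s, IsSelfAdjoint (H g))
    (hgap : ∀ g ∈ s, IsGappedGroundState Δ (H g) (Φ g)) {g : ℝ} (hg : g ∈ s)
    (hD : HasDerivWithinAt H (D g) s g) :
    HasDerivWithinAt (fun g => groundEnergy (H g) (Φ g)) (inner ℂ (Φ g) (D g (Φ g))).re s g := by
  -- subtract the linear functional of `H` that gives the first-order change
  set L : (E →L[ℂ] E) →L[ℝ] ℝ :=
    Complex.reCLM.comp (((innerSL ℂ (Φ g)).restrictScalars ℝ).comp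
      ((ContinuousLinearMap.apply ℂ E (Φ g)).restrictScalars ℝ)) with hL
  have hLa : ∀ A, L A = (inner ℂ (Φ g) (A (Φ g))).re := fun A => rfl
  have h1 : HasDerivWithinAt (fun x => L (H x)) (L (D g)) s g :=
    (L.hasFDerivAt.comp_hasDerivWithinAt g hD)
  have h2 : HasDerivWithinAt (fun x => groundEnergy (H x) (Φ x) - L (H x)) 0 s g := by
    rw [hasDerivWithinAt_iff_isLittleO]
    simp only [smul_zero, sub_zero]
    have hO : (fun x => H x - H g) =O[nhdsWithin g s] fun x => x - g :=
      hD.hasFDerivWithinAt.isBigO_sub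
    have ho : (fun x => H x - H g) =o[nhdsWithin g s] fun _ => (1 : ℝ) := by
      rw [Asymptotics.isLittleO_one_iff]
      have := hD.continuousWithinAt.tendsto.sub_const (H g)
      rwa [sub_self] at this
    have hsq : (fun x => ‖H x - H g‖ ^ 2) =o[nhdsWithin g s] fun x => x - g := by
      have := (hO.norm_left.mul_isLittleO ho.norm_left)
      simpa only [mul_one, ← sq] using this
    refine (Asymptotics.IsBigO.of_bound (4 / Δ) ?_).trans_isLittleO hsq
    filter_upwards [self_mem_nhdsWithin] with x hx
    have := abs_groundEnergy_sub_le hΔ (hgap g hg) (hsa g hg) (hgap x hx) (hsa x hx)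
    rw [← hLa, map_sub] at this
    rw [Real.norm_eq_abs, Real.norm_of_nonneg (sq_nonneg _)]
    refine le_trans (le_of_eq ?_) this
    congr 1
    ring
  have h3 := h2.add h1
  rw [zero_add] at h3
  exact h3.congr (fun x _ => (sub_add_cancel _ _).symm) (sub_add_cancel _ _).symm

/-! ### The action of the filtered generator on the ground state -/

lemma phaseExp_apply_of_apply_eq {e : ℝ} {v : E} (hv : H v = (e : ℂ) • v) (t : ℝ) :
    phaseExp H t v = Complex.exp (Complex.I * e * t) • v := by
  have hcomm : ∀ t, H (phaseExp H t v) = (e : ℂ) • phaseExp H t v := by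
    intro t
    have := congrArg (fun A : E →L[ℂ] E => A v) ((Commute.refl H).phaseExp_right t).eq
    simp only [mul_apply_eq_comp, hv, map_smul] at this
    exact this
  -- `e^{-iet} e^{iHt} v` is constant
  have hder : ∀ t : ℝ, HasDerivAt
      (fun t : ℝ => Complex.exp (-(Complex.I * e * t)) • phaseExp H t v) 0 t := by
    intro t
    have h1 : HasDerivAt (fun t : ℝ => phaseExp H t v)
        (Complex.I • (e : ℂ) • phaseExp H t v) t := by
      have h := (hasDerivAt_phaseExp H t)
      have h2 := (((ContinuousLinearMap.apply ℂ E v).restrictScalars ℝ).hasFDerivAt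
        (x := phaseExp H t)).comp_hasDerivAt t h
      have e1 : ((ContinuousLinearMap.apply ℂ E v).restrictScalars ℝ)
          (Complex.I • (H * phaseExp H t)) = Complex.I • (e : ℂ) • phaseExp H t v := by
        rw [← hcomm]; rfl
      rw [e1] at h2
      exact h2
    have h3 : HasDerivAt (fun t : ℝ => Complex.exp (-(Complex.I * e * t)))
        (Complex.exp (-(Complex.I * e * t)) * (-(Complex.I * e))) t := by
      have h4 : HasDerivAt (fun t : ℝ => -(Complex.I * e * (t : ℂ))) (-(Complex.I * e)) t := by
        simpa using! ((Complex.ofRealCLM.hasDerivAt (x := t)).const_mul (Complex.I * e)).neg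
      exact h4.cexp
    refine (h3.smul h1).congr_deriv ?_
    simp only [smul_smul, ← add_smul]
    convert zero_smul ℂ (phaseExp H t v) using 2
    ring
  have hconst := is_const_of_deriv_eq_zero (fun t => (hder t).differentiableAt)
    (fun t => (hder t).deriv) t 0
  simp only [Complex.ofReal_zero, mul_zero, neg_zero, Complex.exp_zero, one_smul, phaseExp_zero,
    one_apply_eq_self] at hconst
  have := congrArg (fun x => Complex.exp (Complex.I * e * t) • x) hconst
  simpa only [smul_smul, ← Complex.exp_add, add_neg_cancel, Complex.exp_zero, one_smul] using this

end Gap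

lemma IsFilterFunction.timeFourier_zero {Δ : ℝ} {F : ℝ → ℂ} (hF : IsFilterFunction Δ F) :
    timeFourier F 0 = 0 := by
  have h1 : timeFourier F 0 = ∫ t, F t := by simp [timeFourier]
  have h2 : ∫ t, F t = -∫ t, F t := by
    nth_rw 1 [← integral_neg_eq_self]
    rw [← integral_neg]
    exact integral_congr_ae (Filter.Eventually.of_forall fun t => by
      simp only; rw [hF.odd t, neg_neg])
  rw [h1]
  exact self_eq_neg.1 h2

/-- By continuity, the Fourier transform of a filter function is `-1/w` at the gap as well. -/
lemma IsFilterFunction.timeFourier_of_le {Δ : ℝ} (hΔ : 0 < Δ) {F : ℝ → ℂ}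
    (hF : IsFilterFunction Δ F) {w : ℝ} (hw : Δ ≤ w) : timeFourier F w = -1 / (w : ℂ) := by
  have hw0 : (w : ℂ) ≠ 0 := Complex.ofReal_ne_zero.2 (hΔ.trans_le hw).ne'
  have h1 : Filter.Tendsto (timeFourier F) (nhdsWithin w (Ioi w)) (nhds (timeFourier F w)) :=
    (hF.fourier_smooth.continuous.tendsto w).mono_left nhdsWithin_le_nhds
  have h2 : Filter.Tendsto (fun x : ℝ => -1 / (x : ℂ)) (nhdsWithin w (Ioi w))
      (nhds (-1 / (w : ℂ))) :=
    ((tendsto_const_nhds).div (Complex.continuous_ofReal.tendsto w) hw0).mono_left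
      nhdsWithin_le_nhds
  refine tendsto_nhds_unique h1 (h2.congr' ?_)
  filter_upwards [self_mem_nhdsWithin] with x hx
  exact (hF.fourier_eq x (lt_of_lt_of_le (lt_of_le_of_lt hw hx) (le_abs_self x))).symm

section Generator

variable {E : Type*} [NormedAddCommGroup E] [InnerProductSpace ℂ E] [CompleteSpace E]
  {Δ : ℝ} {H : E →L[ℂ] E} {Φ : E} {F : ℝ → ℂ}

/-- Filtering the evolution of an eigenvector multiplies it by the Fourier transform of the filter
function at the energy difference. -/
lemma integral_smul_phaseExp_apply {e ℓ : ℝ} {v : E} (hv : H v = (ℓ : ℂ) • v) :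
    ∫ t : ℝ, (F t * Complex.exp (-(Complex.I * e * t))) • phaseExp H t v =
      timeFourier F (ℓ - e) • v := by
  rw [timeFourier, ← integral_smul_const]
  refine integral_congr_ae (Filter.Eventually.of_forall fun t => ?_)
  simp only [phaseExp_apply_of_apply_eq hv, smul_smul]
  rw [mul_assoc, ← Complex.exp_add]
  congr 3
  push_cast
  ring

/-- The generator applied to the ground state solves the equation of first-order perturbation
theory, and it creates no component along the ground state. -/
theorem filteredOp_apply_groundState [FiniteDimensional ℂ E] (hΔ : 0 < Δ)
    (hF : IsFilterFunction Δ F) (h : IsGappedGroundState Δ H Φ) (hH : IsSelfAdjoint H)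
    (D : E →L[ℂ] E) :
    inner ℂ Φ (filteredOp F H D Φ) = (0 : ℂ) ∧
    H (filteredOp F H D Φ) - (groundEnergy H Φ : ℂ) • filteredOp F H D Φ =
      -(Complex.I • (D Φ - (inner ℂ Φ (D Φ) : ℂ) • Φ)) := by
  obtain ⟨n, v, ℓ, hv0, hv, hℓ, hsum⟩ := h.exists_eigenbasis hH
  obtain ⟨u, hu, hdec⟩ := h.exists_orthogonal_decomposition (D Φ)
  set e := groundEnergy H Φ with he
  set c : Fin n → ℂ := fun i => inner ℂ (v i) u with hc
  have hFΦ : Integrable fun t : ℝ => F t * Complex.exp (-(Complex.I * e * t)) := by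
    have := integrable_mul_exp hF.integrable (-e)
    simpa using this
  have hint : ∀ x : E, Integrable fun t : ℝ =>
      (F t * Complex.exp (-(Complex.I * e * t))) • phaseExp H t x := by
    intro x
    refine (hFΦ.norm.mul_const ‖x‖).mono' (hFΦ.1.smul ?_) (Filter.Eventually.of_forall fun t => ?_)
    · exact ((continuous_phaseExp H).clm_apply continuous_const).aestronglyMeasurable
    · rw [norm_smul]
      gcongr
      have hU := phaseExp_mem_unitary hH t
      have : ‖phaseExp H t‖ ≤ 1 := by
        have := CStarRing.norm_mem_unitary_mul (1 : E →L[ℂ] E) hU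
        rw [mul_one] at this
        rw [this]
        exact ContinuousLinearMap.norm_id_le
      exact ((phaseExp H t).le_opNorm x).trans (mul_le_of_le_one_left (norm_nonneg _) this)
  have hint' : ∀ (a : ℂ) (x : E), Integrable fun t : ℝ =>
      a • ((F t * Complex.exp (-(Complex.I * e * t))) • phaseExp H t x) :=
    fun a x => (hint x).smul a
  have hK : filteredOp F H D Φ = -(Complex.I • ∑ i, (c i / ((ℓ i - e : ℝ) : ℂ)) • v i) := by
    have e1 : filteredOp F H D Φ = Complex.I • ∫ t : ℝ,
        (F t * Complex.exp (-(Complex.I * e * t))) • phaseExp H t (D Φ) := by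
      rw [filteredOp_eq, smul_apply,
        ContinuousLinearMap.integral_apply (integrable_smul_heisenberg hF.integrable hH D)]
      congr 1
      refine integral_congr_ae (Filter.Eventually.of_forall fun t => ?_)
      simp only [heisenberg, smul_apply, mul_apply_eq_comp, phaseExp_apply_of_apply_eq h.apply_eq,
        map_smul, smul_smul, ← he]
      simp
    have e2 : ∫ t : ℝ, (F t * Complex.exp (-(Complex.I * e * t))) • phaseExp H t (D Φ) =
        ∑ i, c i • timeFourier F (ℓ i - e) • v i := by
      have e3 : ∀ t : ℝ, (F t * Complex.exp (-(Complex.I * e * t))) • phaseExp H t (D Φ) =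
          (inner ℂ Φ (D Φ) : ℂ) • ((F t * Complex.exp (-(Complex.I * e * t))) • phaseExp H t Φ) +
          ∑ i, c i • ((F t * Complex.exp (-(Complex.I * e * t))) • phaseExp H t (v i)) := by
        intro t
        nth_rw 1 [hdec]
        nth_rw 1 [hsum u hu]
        simp only [map_add, map_smul, map_sum, smul_add, Finset.smul_sum, hc]
        congr 1
        · exact smul_comm _ _ _
        · exact Finset.sum_congr rfl fun i _ => smul_comm _ _ _
      simp_rw [e3]
      rw [integral_add (hint' _ Φ) (integrable_finsetSum _ fun i _ => hint' (c i) (v i)),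
        integral_finsetSum _ fun i _ => hint' (c i) (v i), integral_smul,
        integral_smul_phaseExp_apply h.apply_eq, ← he, sub_self,
        hF.timeFourier_zero, zero_smul, smul_zero, zero_add]
      refine Finset.sum_congr rfl fun i _ => ?_
      rw [integral_smul, integral_smul_phaseExp_apply (hv i)]
    rw [e1, e2, ← smul_neg, ← Finset.sum_neg_distrib]
    congr 1
    refine Finset.sum_congr rfl fun i _ => ?_
    rw [hF.timeFourier_of_le hΔ (by linarith [hℓ i]), smul_smul, ← neg_smul]
    congr 1
    ring
  refine ⟨?_, ?_⟩
  · rw [hK, inner_neg_right, inner_smul_right, inner_sum]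
    simp [inner_smul_right, hv0]
  · have hDu : D Φ - (inner ℂ Φ (D Φ) : ℂ) • Φ = u := by
      nth_rw 1 [hdec]
      abel
    rw [hDu, hK, map_neg, map_smul, map_sum, smul_neg, smul_comm _ Complex.I, ← neg_add_eq_sub,
      neg_neg, ← sub_eq_add_neg, ← smul_sub, Finset.smul_sum, ← Finset.sum_sub_distrib]
    nth_rw 1 [hsum u hu]
    rw [← smul_neg, ← Finset.sum_neg_distrib]
    congr 1
    refine Finset.sum_congr rfl fun i _ => ?_
    have hne : ((ℓ i : ℂ) - e) ≠ 0 := by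
      rw [← Complex.ofReal_sub]
      exact Complex.ofReal_ne_zero.2 (by linarith [hℓ i])
    rw [map_smul, hv, smul_smul, smul_smul, ← sub_smul, ← neg_smul]
    congr 1
    push_cast
    field_simp
    ring

end Generator

/-! ### Transport of the ground state along the path -/

/-- Application of complex linear operators, as a bilinear map over the reals. -/
lemma isBoundedBilinearMap_clm_apply {E : Type*} [NormedAddCommGroup E] [NormedSpace ℂ E] :
    IsBoundedBilinearMap ℝ fun p : (E →L[ℂ] E) × E => p.1 p.2 where
  add_left A B x := rfl
  smul_left c A x := rfl
  add_right A x y := map_add A x y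
  smul_right c A x := A.map_smul_of_tower c x
  bound := ⟨1, one_pos, fun A x => by simpa using A.le_opNorm x⟩

lemma mem_unitary_of_star_mul_self {E : Type*} [NormedAddCommGroup E] [InnerProductSpace ℂ E]
    [CompleteSpace E] [FiniteDimensional ℂ E] {U : E →L[ℂ] E} (h : star U * U = 1) :
    U ∈ unitary (E →L[ℂ] E) := by
  refine Unitary.mem_iff.2 ⟨h, ?_⟩
  have h1 : ((star U : E →L[ℂ] E) : E →ₗ[ℂ] E) * (U : E →ₗ[ℂ] E) = 1 := by
    rw [← ContinuousLinearMap.toLinearMap_mul, h]; rfl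
  have h2 := mul_eq_one_comm.1 h1
  rw [← ContinuousLinearMap.toLinearMap_mul] at h2
  exact ContinuousLinearMap.coe_injective h2

/-- A Hermitian generator has a unitary ordered exponential. -/
theorem orderedExp_mem_unitary {E : Type*} [NormedAddCommGroup E] [InnerProductSpace ℂ E]
    [CompleteSpace E] [FiniteDimensional ℂ E] {K : ℝ → E →L[ℂ] E}
    (hK : IntervalIntegrable K volume 0 1)
    (hsa : ∀ g ∈ Icc (0 : ℝ) 1, IsSelfAdjoint (K g)) {s : ℝ} (hs : s ∈ Icc (0 : ℝ) 1) :
    orderedExp K s ∈ unitary (E →L[ℂ] E) := by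
  have hU := isPrimitive_orderedExp hK
  have hstar := hU.clm_comp
    ((starL' ℝ : (E →L[ℂ] E) ≃L[ℝ] (E →L[ℂ] E)) : (E →L[ℂ] E) →L[ℝ] (E →L[ℂ] E))
  have hmul := IsPrimitive.bilinear (isBoundedBilinearMap_mul (𝕜 := ℝ) (A := E →L[ℂ] E)) hstar hU
  have hconst := hmul.eq_of_deriv_zero (fun g hg => by
    change star ((-Complex.I) • (K g * orderedExp K g)) * orderedExp K g +
      star (orderedExp K g) * ((-Complex.I) • (K g * orderedExp K g)) = 0
    rw [star_smul, star_mul, (hsa g hg).star_eq, smul_mul_assoc, mul_smul_comm, mul_assoc]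
    simp) hs
  refine mem_unitary_of_star_mul_self ?_
  have h0 : star (orderedExp K 0) * orderedExp K 0 = 1 := by rw [orderedExp_zero]; simp
  exact hconst.trans h0

/-- A path of Hamiltonians with gapped ground states, differentiable on `[0,1]` with integrable
derivative `D`. -/
structure IsGappedPath {E : Type*} [NormedAddCommGroup E] [InnerProductSpace ℂ E]
    [CompleteSpace E] (Δ : ℝ) (H D : ℝ → E →L[ℂ] E) (Φ : ℝ → E) : Prop where
  selfAdjoint : ∀ g ∈ Icc (0 : ℝ) 1, IsSelfAdjoint (H g)
  gapped : ∀ g ∈ Icc (0 : ℝ) 1, IsGappedGroundState Δ (H g) (Φ g)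
  hasDeriv : ∀ g ∈ Icc (0 : ℝ) 1, HasDerivWithinAt H (D g) (Icc 0 1) g
  deriv_selfAdjoint : ∀ g ∈ Icc (0 : ℝ) 1, IsSelfAdjoint (D g)
  integrable : IntervalIntegrable D volume 0 1

namespace IsGappedPath

variable {E : Type*} [NormedAddCommGroup E] [InnerProductSpace ℂ E] [CompleteSpace E]
  {Δ : ℝ} {H D : ℝ → E →L[ℂ] E} {Φ : ℝ → E} {F : ℝ → ℂ}

lemma intervalIntegrable_generator (h : IsGappedPath Δ H D Φ) (hF : Integrable F) :
    IntervalIntegrable (fun g => filteredOp F (H g) (D g)) volume 0 1 :=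
  intervalIntegrable_filteredOp hF (fun g hg => (h.hasDeriv g hg).continuousWithinAt)
    h.selfAdjoint h.integrable

lemma isPrimitive_state (h : IsGappedPath Δ H D Φ) (hF : Integrable F) (v : E) :
    IsPrimitive (fun s => orderedExp (fun g => filteredOp F (H g) (D g)) s v)
      (fun s => (-Complex.I) • filteredOp F (H s) (D s)
        (orderedExp (fun g => filteredOp F (H g) (D g)) s v)) :=
  (isPrimitive_orderedExp (h.intervalIntegrable_generator hF)).clm_comp
    ((ContinuousLinearMap.apply ℂ E v).restrictScalars ℝ)

variable [FiniteDimensional ℂ E]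

/-- The ground state energy is absolutely continuous. The Hellmann–Feynman expression is measurable
because it is a derivative, although nothing is assumed about the dependence of `Φ` on `g`. -/
lemma isPrimitive_groundEnergy (hΔ : 0 < Δ) (h : IsGappedPath Δ H D Φ) :
    IsPrimitive (fun g => groundEnergy (H g) (Φ g)) (fun g => (inner ℂ (Φ g) (D g (Φ g))).re) := by
  have hder : ∀ g ∈ Icc (0 : ℝ) 1, HasDerivWithinAt (fun g => groundEnergy (H g) (Φ g))
      (inner ℂ (Φ g) (D g (Φ g))).re (Icc 0 1) g := fun g hg =>
    hasDerivWithinAt_groundEnergy hΔ h.selfAdjoint h.gapped hg (h.hasDeriv g hg)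
  refine IsPrimitive.of_hasDerivWithinAt ?_ hder
  have hD := h.integrable
  rw [intervalIntegrable_iff_integrableOn_Ioo_of_le zero_le_one] at hD ⊢
  refine hD.norm.mono' ?_ ?_
  · refine (measurable_deriv fun g => groundEnergy (H g) (Φ g)).aestronglyMeasurable.congr ?_
    filter_upwards [ae_restrict_mem measurableSet_Ioo] with g hg
    exact ((hder g (Ioo_subset_Icc_self hg)).hasDerivAt (Icc_mem_nhds hg.1 hg.2)).deriv
  · filter_upwards [ae_restrict_mem measurableSet_Ioo] with g hg
    have hn := (h.gapped g (Ioo_subset_Icc_self hg)).1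
    calc _ ≤ ‖(inner ℂ (Φ g) (D g (Φ g)) : ℂ)‖ := Complex.abs_re_le_norm _
      _ ≤ ‖Φ g‖ * ‖D g (Φ g)‖ := norm_inner_le_norm _ _
      _ ≤ ‖Φ g‖ * (‖D g‖ * ‖Φ g‖) := by gcongr; exact (D g).le_opNorm _
      _ = ‖D g‖ := by rw [hn]; ring

/-- Along a solution `ψ` of the evolution equation `ψ' = -i H̃ ψ`, the derivative of `(H - E₀) ψ` is
the operator `∂H - ∂E₀ - i (H - E₀) H̃` applied to `ψ`. This operator annihilates the ground
state. -/
lemma velocity_apply_eq_zero (hΔ : 0 < Δ) (h : IsGappedPath Δ H D Φ)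
    (hF : IsFilterFunction Δ F) {g : ℝ} (hg : g ∈ Icc (0 : ℝ) 1) :
    D g (Φ g) - (inner ℂ (Φ g) (D g (Φ g))).re • Φ g -
      Complex.I • (H g (filteredOp F (H g) (D g) (Φ g)) -
        groundEnergy (H g) (Φ g) • filteredOp F (H g) (D g) (Φ g)) = 0 := by
  have h1 := (filteredOp_apply_groundState hΔ hF (h.gapped g hg) (h.selfAdjoint g hg) (D g)).2
  have h2 : (((inner ℂ (Φ g) (D g (Φ g))).re : ℝ) : ℂ) = inner ℂ (Φ g) (D g (Φ g)) := by
    have := (h.deriv_selfAdjoint g hg).inner_map_comm (Φ g) (Φ g)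
    rw [← Complex.conj_eq_iff_re, inner_conj_symm, this]
  rw [← Complex.coe_smul, ← Complex.coe_smul, h1, h2, smul_neg, smul_smul, Complex.I_mul_I]
  simp

/-- The evolution keeps the state inside the eigenspace of the ground state energy. -/
theorem apply_orderedExp_eq (hΔ : 0 < Δ) (h : IsGappedPath Δ H D Φ)
    (hF : IsFilterFunction Δ F) {s : ℝ} (hs : s ∈ Icc (0 : ℝ) 1) :
    orderedExp (fun g => filteredOp F (H g) (D g)) s (Φ 0) =
      (inner ℂ (Φ s) (orderedExp (fun g => filteredOp F (H g) (D g)) s (Φ 0)) : ℂ) • Φ s := by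
  set K : ℝ → E →L[ℂ] E := fun g => filteredOp F (H g) (D g) with hKdef
  set ψ : ℝ → E := fun s => orderedExp K s (Φ 0) with hψ
  set e : ℝ → ℝ := fun g => groundEnergy (H g) (Φ g) with he
  set e' : ℝ → ℝ := fun g => (inner ℂ (Φ g) (D g (Φ g))).re with he'
  have hK : IntervalIntegrable K volume 0 1 := h.intervalIntegrable_generator hF.integrable
  have hHP : IsPrimitive H D := IsPrimitive.of_hasDerivWithinAt h.integrable h.hasDeriv
  have hG : IsPrimitive (fun g => H g - e g • (1 : E →L[ℂ] E))
      (fun g => D g - e' g • (1 : E →L[ℂ] E)) :=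
    hHP.sub ((isPrimitive_groundEnergy hΔ h).clm_comp
      (ContinuousLinearMap.toSpanSingleton ℝ (1 : E →L[ℂ] E)))
  have hχ := IsPrimitive.bilinear isBoundedBilinearMap_clm_apply hG
    (h.isPrimitive_state hF.integrable (Φ 0))
  set T : ℝ → E →L[ℂ] E := fun g => (D g - e' g • (1 : E →L[ℂ] E)) +
    (-Complex.I) • ((H g - e g • (1 : E →L[ℂ] E)) * K g) with hT
  have hTint : IntervalIntegrable T volume 0 1 :=
    hG.integrable.add ((hK.continuousOn_mul (by
      rw [uIcc_of_le zero_le_one]; exact hG.continuousOn)).smul (-Complex.I))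
  have hTa : ∀ g v, T g v = (D g v - e' g • v) - Complex.I • (H g (K g v) - e g • K g v) := by
    intro g v
    simp only [hT, add_apply, smul_apply, mul_apply_eq_comp, one_apply_eq_self,
      neg_smul, sub_eq_add_neg,
      neg_apply]
  have hzero : ∀ s ∈ Icc (0 : ℝ) 1, (H s - e s • (1 : E →L[ℂ] E)) (ψ s) = 0 := by
    refine hχ.eq_zero_of_norm_le (k := fun g => ‖T g‖ / Δ) (hTint.norm.div_const Δ)
      (fun g _ => by positivity) ?_ fun g hg => ?_
    · have h0 := (h.gapped 0 (by simp)).apply_eq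
      simp only [orderedExp_zero, one_apply_eq_self, sub_apply, smul_apply, h0, he,
        Complex.coe_smul, sub_self]
    · obtain ⟨w, hw, hdec⟩ := (h.gapped g hg).exists_orthogonal_decomposition (ψ g)
      set c : ℂ := inner ℂ (Φ g) (ψ g)
      have h1 : (D g - e' g • (1 : E →L[ℂ] E)) (ψ g) +
          (H g - e g • (1 : E →L[ℂ] E)) ((-Complex.I) • K g (ψ g)) = T g (ψ g) := by
        simp only [hT, add_apply, smul_apply, mul_apply_eq_comp, map_smul]
      have h2 : T g (ψ g) = T g w := by
        have : T g (Φ g) = 0 := by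
          rw [hTa]
          exact velocity_apply_eq_zero hΔ h hF hg
        rw [hdec, map_add, map_smul, this, smul_zero, zero_add]
      have h3 : (H g - e g • (1 : E →L[ℂ] E)) (ψ g) = H g w - (e g : ℂ) • w := by
        have h0 := (h.gapped g hg).apply_eq
        rw [hdec, map_add, map_smul]
        simp only [sub_apply, smul_apply, one_apply_eq_self, h0, he, Complex.coe_smul, sub_self,
          smul_zero, zero_add]
      have h4 := (h.gapped g hg).norm_le (h.selfAdjoint g hg) hw
      change ‖(D g - e' g • (1 : E →L[ℂ] E)) (ψ g) +
          (H g - e g • (1 : E →L[ℂ] E)) ((-Complex.I) • K g (ψ g))‖ ≤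
          ‖T g‖ / Δ * ‖(H g - e g • (1 : E →L[ℂ] E)) (ψ g)‖
      rw [h1, h2, h3]
      calc ‖T g w‖ ≤ ‖T g‖ * ‖w‖ := (T g).le_opNorm w
        _ = ‖T g‖ / Δ * (Δ * ‖w‖) := by field_simp
        _ ≤ _ := by gcongr
  obtain ⟨w, hw, hdec⟩ := (h.gapped s hs).exists_orthogonal_decomposition (ψ s)
  have h0 := (h.gapped s hs).apply_eq
  have h3 : H s w - (e s : ℂ) • w = 0 := by
    rw [← hzero s hs]
    conv_rhs => rw [hdec, map_add, map_smul]
    simp only [sub_apply, smul_apply, one_apply_eq_self, h0, he, Complex.coe_smul, sub_self,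
      smul_zero, zero_add]
  have h4 := (h.gapped s hs).norm_le (h.selfAdjoint s hs) hw
  rw [h3, norm_zero] at h4
  have h5 : w = 0 := norm_eq_zero.1
    (le_antisymm (nonpos_of_mul_nonpos_right h4 hΔ) (norm_nonneg w))
  rw [h5, add_zero] at hdec
  exact hdec

/-- The evolution preserves the norm of the ground state even if the generator is not Hermitian,
because the generator has no diagonal matrix element in the ground state. -/
theorem exists_phase (hΔ : 0 < Δ) (h : IsGappedPath Δ H D Φ)
    (hF : IsFilterFunction Δ F) {s : ℝ} (hs : s ∈ Icc (0 : ℝ) 1) :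
    ∃ c : ℂ, ‖c‖ = 1 ∧ c • Φ s = orderedExp (fun g => filteredOp F (H g) (D g)) s (Φ 0) := by
  set K : ℝ → E →L[ℂ] E := fun g => filteredOp F (H g) (D g) with hKdef
  set ψ : ℝ → E := fun s => orderedExp K s (Φ 0) with hψ
  have hψs : ∀ s ∈ Icc (0 : ℝ) 1, ψ s = (inner ℂ (Φ s) (ψ s) : ℂ) • Φ s := fun s hs =>
    apply_orderedExp_eq hΔ h hF hs
  have hP : IsPrimitive ψ fun s => (-Complex.I) • K s (ψ s) :=
    h.isPrimitive_state hF.integrable (Φ 0)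
  have hN := IsPrimitive.bilinear (isBoundedBilinearMap_inner (𝕜 := ℂ) (E := E)) hP hP
  have h0 : ∀ s ∈ Icc (0 : ℝ) 1, inner ℂ (ψ s) ((-Complex.I) • K s (ψ s)) = (0 : ℂ) := by
    intro s hs
    have := (filteredOp_apply_groundState hΔ hF (h.gapped s hs) (h.selfAdjoint s hs) (D s)).1
    rw [hψs s hs, map_smul, inner_smul_right, inner_smul_right, inner_smul_left]
    simp only [hKdef, this, mul_zero]
  have hconst := hN.eq_of_deriv_zero (fun s hs => by
    change inner ℂ ((-Complex.I) • K s (ψ s)) (ψ s) + inner ℂ (ψ s) ((-Complex.I) • K s (ψ s)) =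
      (0 : ℂ)
    rw [h0 s hs, ← inner_conj_symm, h0 s hs, map_zero, add_zero]) hs
  have hψ0 : ψ 0 = Φ 0 := by simp [hψ, orderedExp_zero]
  have hnorm : ‖ψ s‖ = 1 := by
    have h1 : (inner ℂ (ψ s) (ψ s) : ℂ) = 1 := by
      have := (h.gapped 0 (by simp)).inner_self
      rw [← hψ0] at this
      exact hconst.trans this
    rw [inner_self_eq_ofReal_norm_sq] at h1
    have h2 : ‖ψ s‖ ^ 2 = 1 := by exact_mod_cast h1
    exact (pow_eq_one_iff_of_nonneg (norm_nonneg _) two_ne_zero).1 h2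
  refine ⟨inner ℂ (Φ s) (ψ s), ?_, (hψs s hs).symm⟩
  rw [hψs s hs, norm_smul, (h.gapped s hs).1, mul_one] at hnorm
  exact hnorm

/-- A parallel transported family of ground states solves the evolution equation. -/
theorem eq_orderedExp_of_parallel (hΔ : 0 < Δ) (h : IsGappedPath Δ H D Φ)
    (hF : IsFilterFunction Δ F) (hΦ : DifferentiableOn ℝ Φ (Icc 0 1))
    (hpar : ∀ g ∈ Icc (0 : ℝ) 1, inner ℂ (Φ g) (pathDeriv Φ g) = (0 : ℂ)) {s : ℝ}
    (hs : s ∈ Icc (0 : ℝ) 1) :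
    Φ s = orderedExp (fun g => filteredOp F (H g) (D g)) s (Φ 0) := by
  set K : ℝ → E →L[ℂ] E := fun g => filteredOp F (H g) (D g) with hKdef
  have hK : IntervalIntegrable K volume 0 1 := h.intervalIntegrable_generator hF.integrable
  have hΦder : ∀ g ∈ Icc (0 : ℝ) 1, HasDerivWithinAt Φ ((-Complex.I) • K g (Φ g)) (Icc 0 1) g := by
    intro g hg
    have hd : HasDerivWithinAt Φ (pathDeriv Φ g) (Icc 0 1) g := (hΦ g hg).hasDerivWithinAt
    have hE := hasDerivWithinAt_groundEnergy hΔ h.selfAdjoint h.gapped hg (h.hasDeriv g hg)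
    have hHΦ : HasDerivWithinAt (fun g => H g (Φ g)) (D g (Φ g) + H g (pathDeriv Φ g))
        (Icc 0 1) g := by
      have := (isBoundedBilinearMap_clm_apply.hasFDerivAt (H g, Φ g)).comp_hasDerivWithinAt g
        ((h.hasDeriv g hg).prodMk hd)
      simp only [IsBoundedBilinearMap.deriv_apply] at this
      rw [add_comm] at this
      exact this
    have h1 := hHΦ.sub (hE.smul hd)
    have h2 : HasDerivWithinAt (fun _ : ℝ => (0 : E)) _ (Icc 0 1) g := h1.congr (fun x hx => by
        have := (h.gapped x hx).apply_eq
        simp only [Pi.sub_apply, Pi.smul_apply', this, Complex.coe_smul, sub_self]) (by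
        have := (h.gapped g hg).apply_eq
        simp only [Pi.sub_apply, Pi.smul_apply', this, Complex.coe_smul, sub_self])
    have h3 := (uniqueDiffOn_Icc (zero_lt_one' ℝ) g hg).eq_deriv _ h2
      (hasDerivWithinAt_const g (Icc 0 1) 0)
    have hv := velocity_apply_eq_zero hΔ h hF hg
    have h4 : inner ℂ (Φ g) (pathDeriv Φ g + Complex.I • K g (Φ g)) = (0 : ℂ) := by
      have := (filteredOp_apply_groundState hΔ hF (h.gapped g hg) (h.selfAdjoint g hg) (D g)).1
      rw [inner_add_right, hpar g hg, inner_smul_right, hKdef, this, mul_zero, add_zero]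
    have h5 : H g (pathDeriv Φ g + Complex.I • K g (Φ g)) -
        (groundEnergy (H g) (Φ g) : ℂ) • (pathDeriv Φ g + Complex.I • K g (Φ g)) = 0 := by
      rw [map_add, map_smul, Complex.coe_smul]
      have h8 : D g (Φ g) + H g (pathDeriv Φ g) - (groundEnergy (H g) (Φ g) • pathDeriv Φ g +
          (inner ℂ (Φ g) (D g (Φ g))).re • Φ g) = 0 := h3
      rw [← sub_zero (0 : E)]
      nth_rw 1 [← h8]
      rw [← hv, smul_sub, smul_add, smul_comm _ Complex.I (K g (Φ g))]
      abel
    have h6 := (h.gapped g hg).norm_le (h.selfAdjoint g hg) h4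
    rw [h5, norm_zero] at h6
    have h7 : pathDeriv Φ g + Complex.I • K g (Φ g) = 0 := norm_eq_zero.1
      (le_antisymm (nonpos_of_mul_nonpos_right h6 hΔ) (norm_nonneg _))
    rw [neg_smul, ← eq_neg_of_add_eq_zero_left h7]
    exact hd
  have hint : IntervalIntegrable (fun g => (-Complex.I) • K g (Φ g)) volume 0 1 := by
    rw [intervalIntegrable_iff_integrableOn_Ioc_of_le zero_le_one] at hK ⊢
    have hΦm : AEStronglyMeasurable Φ (volume.restrict (Ioc (0 : ℝ) 1)) :=
      (hΦ.continuousOn.mono Ioc_subset_Icc_self).aestronglyMeasurable measurableSet_Ioc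
    refine hK.norm.mono' ((isBoundedBilinearMap_clm_apply.continuous.comp_aestronglyMeasurable
      (hK.1.prodMk hΦm)).const_smul (-Complex.I)) ?_
    filter_upwards [ae_restrict_mem measurableSet_Ioc] with g hg
    rw [norm_smul, norm_neg, Complex.norm_I, one_mul]
    have := (K g).le_opNorm (Φ g)
    rwa [(h.gapped g (Ioc_subset_Icc_self hg)).1, mul_one] at this
  have hdiff := (IsPrimitive.of_hasDerivWithinAt hint hΦder).sub
    (h.isPrimitive_state hF.integrable (Φ 0))
  have := hdiff.eq_zero_of_norm_le (k := fun g => ‖K g‖) hK.norm (fun _ _ => norm_nonneg _)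
    (by simp [orderedExp_zero]) (fun g _ => by
      rw [← smul_sub, ← map_sub, norm_smul, norm_neg, Complex.norm_I, one_mul]
      exact (K g).le_opNorm _) s hs
  exact sub_eq_zero.1 this

end IsGappedPath

/-! ### Local families of Hamiltonians -/

section LocalFamily

lemma selfAdjoint_pathDeriv {Λ : Type*} [Fintype Λ] [DecidableEq Λ] {σ : Λ → Type*}
    [∀ x, Fintype (σ x)] {f : ℝ → Op σ} (hf : ∀ g ∈ Icc (0 : ℝ) 1, IsSelfAdjoint (f g)) (g : ℝ) :
    IsSelfAdjoint (pathDeriv f g) :=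
  pathDeriv_mem (selfAdjoint.submodule ℝ (Op σ)) (Submodule.closed_of_finiteDimensional _) hf g

variable {Λ : Type*} [Fintype Λ] [DecidableEq Λ] [MetricSpace Λ] {σ : Λ → Type*}
  [∀ x, Fintype (σ x)] [∀ x, DecidableEq (σ x)] {μ J : ℝ} {H : Finset Λ → ℝ → Op σ}

lemma IsLocalFamily.supportedOn_pathDeriv (hH : IsLocalFamily μ J H) (Z : Finset Λ) (g : ℝ) :
    SupportedOn Z (pathDeriv (H Z) g) :=
  pathDeriv_mem (supportedSubmodule σ Z) (Submodule.closed_of_finiteDimensional _)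
    (hH.supported Z) g

lemma IsLocalFamily.isSelfAdjoint_total (hH : IsLocalFamily μ J H) {g : ℝ}
    (hg : g ∈ Icc (0 : ℝ) 1) : IsSelfAdjoint (totalHamiltonian H g) :=
  isSelfAdjoint_sum (R := Op σ) _ fun Z _ => hH.selfAdjoint Z g hg

lemma IsLocalFamily.hasDerivWithinAt_total (hH : IsLocalFamily μ J H) {g : ℝ}
    (hg : g ∈ Icc (0 : ℝ) 1) :
    HasDerivWithinAt (totalHamiltonian H) (∑ Z, pathDeriv (H Z) g) (Icc 0 1) g :=
  HasDerivWithinAt.fun_sum fun Z _ => (hH.differentiable Z g hg).hasDerivWithinAt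

lemma IsLocalFamily.pathDeriv_total (hH : IsLocalFamily μ J H) {g : ℝ}
    (hg : g ∈ Icc (0 : ℝ) 1) :
    pathDeriv (totalHamiltonian H) g = ∑ Z, pathDeriv (H Z) g :=
  (hH.hasDerivWithinAt_total hg).derivWithin (uniqueDiffOn_Icc (zero_lt_one' ℝ) g hg)

lemma IsLocalFamily.isGappedPath (hH : IsLocalFamily μ J H) {Δ : ℝ} {Φ : ℝ → StateSpace σ}
    (hΦ : ∀ g ∈ Icc (0 : ℝ) 1, IsGappedGroundState Δ (totalHamiltonian H g) (Φ g)) :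
    IsGappedPath Δ (totalHamiltonian H) (pathDeriv (totalHamiltonian H)) Φ where
  selfAdjoint _ hg := hH.isSelfAdjoint_total hg
  gapped := hΦ
  hasDeriv g hg := by
    rw [hH.pathDeriv_total hg]
    exact hH.hasDerivWithinAt_total hg
  deriv_selfAdjoint g _ := selfAdjoint_pathDeriv (fun _ hg => hH.isSelfAdjoint_total hg) g
  integrable := hH.integrable_deriv

end LocalFamily

theorem mainTheorem1 (Δ : ℝ) (hΔ : 0 < Δ) :
    (∃ F : ℝ → ℂ, IsFilterFunction Δ F ∧ ∀ t, (F t).re = 0) ∧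
    ∀ F : ℝ → ℂ, IsFilterFunction Δ F → ∀ μ : ℝ, 0 < μ → ∀ J : ℝ,
      ∃ h : ℝ → ℝ, Asymptotics.SuperpolynomialDecay Filter.atTop (fun l : ℝ => l) h ∧
        ∀ (Λ : Type*) [Fintype Λ] [DecidableEq Λ] [MetricSpace Λ]
          (σ : Λ → Type*) [∀ x, Fintype (σ x)] [∀ x, DecidableEq (σ x)]
          (H : Finset Λ → ℝ → Op σ) (Φ : ℝ → StateSpace σ),
          IsLocalFamily μ J H →
          (∀ g ∈ Icc (0 : ℝ) 1, IsGappedGroundState Δ (totalHamiltonian H g) (Φ g)) →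
          -- the ordered exponential is well defined and maps ground states to ground states
          IntervalIntegrable (quasiAdiabatic F H) volume 0 1 ∧
          (∀ s ∈ Icc (0 : ℝ) 1, Summable fun n => dysonTerm (quasiAdiabatic F H) n s) ∧
          (∀ s ∈ Icc (0 : ℝ) 1, ∃ c : ℂ, ‖c‖ = 1 ∧
            c • Φ s = orderedExp (quasiAdiabatic F H) s (Φ 0)) ∧
          -- the phase is trivial if the ground states are chosen by parallel transport
          (DifferentiableOn ℝ Φ (Icc 0 1) →
            (∀ g ∈ Icc (0 : ℝ) 1, inner ℂ (Φ g) (pathDeriv Φ g) = 0) →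
            ∀ s ∈ Icc (0 : ℝ) 1, Φ s = orderedExp (quasiAdiabatic F H) s (Φ 0)) ∧
          -- for purely imaginary `F` the generator is Hermitian and the evolution is unitary
          ((∀ t, (F t).re = 0) → ∀ s ∈ Icc (0 : ℝ) 1,
            (∀ Z, IsSelfAdjoint (quasiAdiabaticTerm F H Z s)) ∧
            IsSelfAdjoint (quasiAdiabatic F H s) ∧
            orderedExp (quasiAdiabatic F H) s ∈ unitary (Op σ)) ∧
          -- quasi-locality
          ∀ g ∈ Icc (0 : ℝ) 1,
            quasiAdiabatic F H g = ∑ Z : Finset Λ, quasiAdiabaticTerm F H Z g ∧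
            ∀ (Z : Finset Λ) (B : Λ) (O : Op σ), SupportedOn {B} O →
              ‖quasiAdiabaticTerm F H Z g * O - O * quasiAdiabaticTerm F H Z g‖ ≤
                h (Metric.infDist B (Z : Set Λ)) * (Z.card : ℝ) * ‖pathDeriv (H Z) g‖ * ‖O‖ := by
  refine ⟨?_, fun F hF μ hμ J => ?_⟩
  · obtain ⟨F, hF, hre, -⟩ := exists_filterFunction hΔ
    exact ⟨F, hF, hre⟩
  -- the Lieb–Robinson velocity is a multiple of the interaction strength, which may be enlarged
  have hJ0 : 0 < max J 1 := lt_max_of_lt_right one_pos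
  refine ⟨decayProfile F μ (max J 1),
    superpolynomialDecay_decayProfile hF.integrable (hF.integrable_pow_mul hΔ) hμ hJ0, ?_⟩
  intro Λ _ _ _ σ _ _ H Φ hH hΦ
  have hpath := hH.isGappedPath hΦ
  have hint : IntervalIntegrable (quasiAdiabatic F H) volume 0 1 :=
    hpath.intervalIntegrable_generator hF.integrable
  refine ⟨hint, fun s hs => summable_dysonTerm hint hs, fun s hs => hpath.exists_phase hΔ hF hs,
    fun hdiff hpar s hs => hpath.eq_orderedExp_of_parallel hΔ hF hdiff hpar hs,
    fun hre s hs => ?_, fun g hg => ⟨?_, fun Z B O hO => ?_⟩⟩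
  · have hsa : ∀ g ∈ Icc (0 : ℝ) 1, IsSelfAdjoint (quasiAdiabatic F H g) := fun g hg =>
      isSelfAdjoint_filteredOp (hpath.selfAdjoint g hg) (hpath.deriv_selfAdjoint g hg) hre
    exact ⟨fun Z => isSelfAdjoint_filteredOp (hpath.selfAdjoint s hs)
      (selfAdjoint_pathDeriv (hH.selfAdjoint Z) s) hre, hsa s hs,
      orderedExp_mem_unitary hint hsa hs⟩
  · rw [quasiAdiabatic, hH.pathDeriv_total hg, filteredOp_sum hF.integrable
      (hH.isSelfAdjoint_total hg)]
    rfl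
  · exact commutator_filteredOp_le_decayProfile hF.integrable hμ hJ0
      (fun Z => hH.supported Z g hg) (fun Z => hH.selfAdjoint Z g hg)
      (fun u => (hH.local_bound g hg u).trans (le_max_left _ _)) hO
      (hH.supportedOn_pathDeriv Z g)
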